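/- Let $d \ge 1$ be an integer, let $p \in [1,\infty)$, and let $\Omega \subset \mathbb{R}^d$ be a smooth bounded domain (a nonempty, bounded, connected open set which, near each of its boundary points and in suitable orthogonal coordinates, is the region above the graph of a $C^\infty$ function). Let $(\rho_n)_{n \in \mathbb{N}}$ be a sequence of radial mollifiers, that is, $\rho_n \in L^1_{\mathrm{loc}}(0,+\infty)$, $\rho_n \ge 0$, $$\int_0^\infty \rho_n(r)\, r^{d-1}\, dr = 1 \quad \text{for all } n, \qquad \lim_{n \to +\infty} \int_\delta^\infty \rho_n(r)\, r^{d-1}\, dr = 0 \quad \text{for all } \delta > 0.$$ For $u \in W^{1,p}(\Omega)$ (real-valued, with weak gradient $\nabla u$) set $$D^\Omega_{n,p}(u)(x) = \int_\Omega \frac{|u(x)-u(y)|^p}{|x-y|^p}\, \rho_n(|x-y|)\, dy \in [0,+\infty], \qquad x \in \Omega,$$ and let $\gamma_{d,p} = \int_{\mathbb{S}^{d-1}} |\sigma \cdot e|^p\, d\sigma$, where $e \in \mathbb{S}^{d-1}$ is any unit vector and $d\sigma$ is the surface measure (the counting measure on $\{-1,1\}$ if $d=1$). Then, for every $u \in W^{1,p}(\Omega)$,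 $$\lim_{n \to +\infty} D^\Omega_{n,p}(u)(x) = \gamma_{d,p}\, |\nabla u(x)|^p \quad \text{for a.e. } x \in \Omega.$$ -/

import Mathlib

open MeasureTheory Set Filter Topology
open scoped ENNReal ContDiff

noncomputable section

/-- A bounded domain (nonempty connected open set) of `ℝ^d` with `C^∞` boundary: near each boundary
point, in suitable orthogonal coordinates whose last axis is directed by the unit vector `e`, the
set `Ω` is the region above the graph of a `C^∞` function `γ` of the remaining coordinates.
Here `x - ⟪e, x⟫ e` is the orthogonal projection of `x` on the hyperplane `e^⊥`, so only the
restriction of `γ` to that hyperplane matters. -/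
structure IsSmoothBoundedDomain {d : ℕ} (Ω : Set (EuclideanSpace ℝ (Fin d))) : Prop where
  isOpen : IsOpen Ω
  isConnected : IsConnected Ω
  isBounded : Bornology.IsBounded Ω
  smooth_boundary : ∀ x₀ ∈ frontier Ω, ∃ r : ℝ, 0 < r ∧
    ∃ e : EuclideanSpace ℝ (Fin d), ‖e‖ = 1 ∧
    ∃ γ : EuclideanSpace ℝ (Fin d) → ℝ, ContDiff ℝ ∞ γ ∧
      ∀ x ∈ Metric.ball x₀ r, x ∈ Ω ↔ γ (x - inner ℝ e x • e) < inner ℝ e x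

/-- `g` is the weak (distributional) gradient of `u` on the open set `Ω`. -/
structure HasWeakGradient {d : ℕ} (Ω : Set (EuclideanSpace ℝ (Fin d)))
    (u : EuclideanSpace ℝ (Fin d) → ℝ)
    (g : EuclideanSpace ℝ (Fin d) → EuclideanSpace ℝ (Fin d)) : Prop where
  locallyIntegrableOn : LocallyIntegrableOn u Ω
  locallyIntegrableOn_grad : LocallyIntegrableOn g Ω
  integral_eq : ∀ φ : EuclideanSpace ℝ (Fin d) → ℝ, ContDiff ℝ ∞ φ → HasCompactSupport φ →
    tsupport φ ⊆ Ω → ∀ v : EuclideanSpace ℝ (Fin d),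
      ∫ x in Ω, u x * fderiv ℝ φ x v = - ∫ x in Ω, inner ℝ (g x) v * φ x

/-- `u ∈ W^{1,p}(Ω)`, for a real exponent `p`. -/
def MemSobolevOne {d : ℕ} (Ω : Set (EuclideanSpace ℝ (Fin d))) (p : ℝ)
    (u : EuclideanSpace ℝ (Fin d) → ℝ) : Prop :=
  MemLp u (ENNReal.ofReal p) (volume.restrict Ω) ∧
    ∃ g : EuclideanSpace ℝ (Fin d) → EuclideanSpace ℝ (Fin d),
      HasWeakGradient Ω u g ∧ MemLp g (ENNReal.ofReal p) (volume.restrict Ω)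

/-- `(ρ_n)` is a sequence of radial mollifiers in dimension `d ≥ 1` (given by their radial
profiles on `(0, ∞)`). The second integral condition forces `ρ_n(r) r^(d-1)` to be integrable. -/
structure IsRadialMollifierSeq (d : ℕ) (ρ : ℕ → ℝ → ℝ) : Prop where
  locallyIntegrableOn : ∀ n, LocallyIntegrableOn (ρ n) (Ioi 0)
  nonneg : ∀ n, ∀ r, 0 < r → 0 ≤ ρ n r
  integral_eq_one : ∀ n, ∫ r in Ioi (0 : ℝ), ρ n r * r ^ (d - 1) = 1
  tendsto_tail : ∀ δ : ℝ, 0 < δ →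
    Tendsto (fun n => ∫ r in Ioi δ, ρ n r * r ^ (d - 1)) atTop (𝓝 0)

/-- The functional `D^Ω_{n,p}(u)(x) = ∫_Ω |u(x) - u(y)|^p / |x - y|^p ρ_n(|x - y|) dy`, with values
in `[0, ∞]`, for the radial profile `ρ = ρ_n`. -/
def truncatedD {d : ℕ} (Ω : Set (EuclideanSpace ℝ (Fin d))) (p : ℝ) (ρ : ℝ → ℝ)
    (u : EuclideanSpace ℝ (Fin d) → ℝ) (x : EuclideanSpace ℝ (Fin d)) : ℝ≥0∞ :=
  ∫⁻ y in Ω, ENNReal.ofReal (|u x - u y| ^ p / ‖x - y‖ ^ p * ρ ‖x - y‖)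

/-- `γ_{d,p} = ∫_{S^{d-1}} |σ · e|^p dσ`, the integral for the surface measure of the unit sphere
(counting measure on `{-1, 1}` if `d = 1`), where `e` is a unit vector. -/
def gammaConst {d : ℕ} (p : ℝ) (e : EuclideanSpace ℝ (Fin d)) : ℝ :=
  ∫ σ : Metric.sphere (0 : EuclideanSpace ℝ (Fin d)) 1,
    |inner ℝ (σ : EuclideanSpace ℝ (Fin d)) e| ^ p
    ∂((volume : Measure (EuclideanSpace ℝ (Fin d))).toSphere)

end

/-! Near a point `x`, `u (x + z) - u x` should be `⟪g x, z⟫` up to an error. For almost every `x`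
and `z`, with `‖z‖` less than the distance from `x` to the complement of `Ω`, the fundamental
theorem of calculus along segments bounds this error by `‖z‖` times the mean of `‖g (x + s • z) - g
x‖` over `s ∈ (0, 1)` (`HasWeakGradient.ae_ae_enorm_sub_sub_inner_le`). The linear model is explicit
in polar coordinates: its quotient by `‖z‖` does not depend on the radius, so its integral over a
ball is the mass of the mollifier in that ball times `γ_{d,p} ‖g x‖ ^ p`, and the mass tends to 1.

The profiles need not be monotone, so Lebesgue points cannot be used against the weight directly.
The mean over `s` repairs this. If the integral of `G` over balls of radius `b` is at most `η b ^
d`, a dyadic decomposition bounds the integral of `G` over `(0, 1) × sphere` without the Jacobian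
(`lintegral_sphere_segment_le`), and by scaling this holds on every small sphere. At a Lebesgue
point of order `p` of `g`, the error is therefore small in the weighted `L^p` norm, uniformly in
`n`. Minkowski's inequality then replaces `u` by its linear model
(`tendsto_lintegral_rpow_mul_radial`).

Away from `x` the weight may be unbounded on thin shells, and `u ∈ L^p` alone does not suffice. Near
each point of `closure Ω` other than `x` there is a direction `v`, transversal to the spheres around
`x`, along which `Ω` is stable under short translations. Bounding `|u y| ^ p` by values of `u` and
`g` on the segment from `y` in direction `v`, then averaging over the translation, turns the
singular weight into the one-dimensional integral of the profile. Compactness makes this global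
(`HasWeakGradient.exists_lintegral_radial_le`), and the tail condition concludes. -/

/-! ### Polar coordinates and averages along rays. -/

section Polar

variable {E : Type*} [NormedAddCommGroup E] [InnerProductSpace ℝ E] [FiniteDimensional ℝ E]
  [MeasurableSpace E] [BorelSpace E]

theorem lintegral_comp_smul {G : E → ℝ≥0∞} (hG : Measurable G) {r : ℝ} (hr : 0 < r) :
    ∫⁻ z, G (r • z) = ENNReal.ofReal (r ^ Module.finrank ℝ E)⁻¹ * ∫⁻ z, G z := by
  have := Measure.map_addHaar_smul (volume : Measure E) hr.ne'
  rw [← lintegral_map hG (measurable_const_smul r), this, lintegral_smul_measure,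
    abs_of_pos (by positivity)]
  rfl

theorem measurable_lintegral_sphere_smul {f : E → ℝ≥0∞} (hf : Measurable f) :
    Measurable fun r : ℝ => ∫⁻ σ : Metric.sphere (0 : E) 1, f (r • (σ : E))
      ∂(volume : Measure E).toSphere := by
  have hF : Measurable fun q : ℝ × Metric.sphere (0 : E) 1 => f (q.1 • (q.2 : E)) := by
    apply hf.comp; fun_prop
  exact hF.lintegral_prod_right'

variable [Nontrivial E]

/-- Integration in polar coordinates. -/
theorem lintegral_polar {f : E → ℝ≥0∞} (hf : Measurable f) :
    ∫⁻ y, f y = ∫⁻ r in Ioi (0 : ℝ), ENNReal.ofReal (r ^ (Module.finrank ℝ E - 1)) *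
      ∫⁻ σ : Metric.sphere (0 : E) 1, f (r • (σ : E)) ∂(volume : Measure E).toSphere := by
  have hmp := (volume : Measure E).measurePreserving_homeomorphUnitSphereProd
  have hF : Measurable fun q : Metric.sphere (0 : E) 1 × Ioi (0 : ℝ) =>
      f ((q.2 : ℝ) • (q.1 : E)) := by
    apply hf.comp; fun_prop
  calc ∫⁻ y, f y = ∫⁻ y in ({0}ᶜ : Set E), f y := by rw [restrict_compl_singleton]
    _ = ∫⁻ y : ({0}ᶜ : Set E), f y ∂(volume.comap Subtype.val) := by
      rw [lintegral_subtype_comap (measurableSet_singleton _).compl]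
    _ = ∫⁻ y : ({0}ᶜ : Set E), (fun q : Metric.sphere (0 : E) 1 × Ioi (0 : ℝ) =>
          f ((q.2 : ℝ) • (q.1 : E))) (homeomorphUnitSphereProd E y) ∂(volume.comap Subtype.val) := by
      refine lintegral_congr fun y => ?_
      have hy : ‖(y : E)‖ ≠ 0 := norm_ne_zero_iff.2 y.2
      simp [smul_smul, hy]
    _ = ∫⁻ q, f ((q.2 : ℝ) • (q.1 : E)) ∂((volume : Measure E).toSphere.prod
          (.volumeIoiPow (Module.finrank ℝ E - 1))) := hmp.lintegral_comp hF
    _ = ∫⁻ r : Ioi (0 : ℝ), ∫⁻ σ : Metric.sphere (0 : E) 1, f ((r : ℝ) • (σ : E))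
          ∂(volume : Measure E).toSphere ∂(.volumeIoiPow (Module.finrank ℝ E - 1)) :=
      lintegral_prod_symm' _ hF
    _ = ∫⁻ r : Ioi (0 : ℝ), ENNReal.ofReal ((r : ℝ) ^ (Module.finrank ℝ E - 1)) *
          ∫⁻ σ : Metric.sphere (0 : E) 1, f ((r : ℝ) • (σ : E))
          ∂(volume : Measure E).toSphere ∂(volume.comap Subtype.val) := by
      have h2 : Measurable fun r : Ioi (0 : ℝ) => ∫⁻ σ : Metric.sphere (0 : E) 1,
          f ((r : ℝ) • (σ : E)) ∂(volume : Measure E).toSphere :=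
        (hF.comp measurable_swap).lintegral_prod_right'
      rw [Measure.volumeIoiPow, lintegral_withDensity_eq_lintegral_mul _ (by fun_prop) h2]
      rfl
    _ = _ := by
      rw [lintegral_subtype_comap measurableSet_Ioi (fun r : ℝ =>
        ENNReal.ofReal (r ^ (Module.finrank ℝ E - 1)) *
          ∫⁻ σ : Metric.sphere (0 : E) 1, f (r • (σ : E)) ∂(volume : Measure E).toSphere)]

/-- Integration in polar coordinates of the product of a radial function with another one. -/
theorem lintegral_radial_mul_polar {f : E → ℝ≥0∞} (hf : Measurable f) {R : ℝ → ℝ≥0∞}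
    (hR : Measurable R) :
    ∫⁻ y : E, R ‖y‖ * f y =
      ∫⁻ r in Ioi 0, R r * ENNReal.ofReal (r ^ (Module.finrank ℝ E - 1)) *
      ∫⁻ σ : Metric.sphere (0 : E) 1, f (r • (σ : E)) ∂(volume : Measure E).toSphere := by
  have hm : Measurable fun y : E => R ‖y‖ * f y := (hR.comp measurable_norm).mul hf
  rw [lintegral_polar hm]
  refine setLIntegral_congr_fun measurableSet_Ioi fun r hr => ?_
  have hn : ∀ σ : Metric.sphere (0 : E) 1, ‖r • (σ : E)‖ = r := fun σ => by
    simp [norm_smul, abs_of_pos (mem_Ioi.1 hr)]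
  simp only [hn]
  have hfr : Measurable fun σ : Metric.sphere (0 : E) 1 => f (r • (σ : E)) :=
    hf.comp (by fun_prop)
  rw [lintegral_const_mul _ hfr]
  ring

theorem lintegral_ball_polar {f : E → ℝ≥0∞} (hf : Measurable f) {R : ℝ → ℝ≥0∞}
    (hR : Measurable R) (δ : ℝ) :
    ∫⁻ y in Metric.ball (0 : E) δ, R ‖y‖ * f y =
      ∫⁻ r in Ioo 0 δ, R r * ENNReal.ofReal (r ^ (Module.finrank ℝ E - 1)) *
      ∫⁻ σ : Metric.sphere (0 : E) 1, f (r • (σ : E)) ∂(volume : Measure E).toSphere := by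
  have h := lintegral_radial_mul_polar hf (hR.indicator (measurableSet_Iio (a := δ)))
  have hset : Ioo 0 δ = Iio δ ∩ Ioi 0 := by ext; simp [and_comm]
  rw [← lintegral_indicator Metric.isOpen_ball.measurableSet, hset,
    ← Measure.restrict_restrict measurableSet_Iio, ← lintegral_indicator measurableSet_Iio]
  convert h using 3 with y r
  · by_cases hy : ‖y‖ < δ <;> simp [hy]
  · by_cases hr : r < δ <;> simp [hr]

theorem lintegral_compl_ball_radial {R : ℝ → ℝ≥0∞} (hR : Measurable R) {δ : ℝ} (hδ : 0 < δ) :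
    ∫⁻ y in (Metric.ball (0 : E) δ)ᶜ, R ‖y‖ =
      (∫⁻ r in Ici δ, R r * ENNReal.ofReal (r ^ (Module.finrank ℝ E - 1))) *
      (volume : Measure E).toSphere univ := by
  have h := lintegral_radial_mul_polar (E := E) (f := fun _ => 1) measurable_const
    (hR.indicator (measurableSet_Ici (a := δ)))
  have hset : Ici δ = Ici δ ∩ Ioi 0 := by
    ext r; simp only [mem_Ici, mem_inter_iff, mem_Ioi]; grind
  rw [← lintegral_indicator Metric.isOpen_ball.measurableSet.compl, hset,
    ← Measure.restrict_restrict measurableSet_Ici, ← lintegral_indicator measurableSet_Ici,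
    ← lintegral_mul_const]
  · convert h using 3 with y r
    · by_cases hy : ‖y‖ < δ
      · simp [hy]
      · simp [hy, not_lt.1 hy]
    · by_cases hr : δ ≤ r <;> simp [hr]
  · exact (hR.mul (by fun_prop)).indicator measurableSet_Ici

/-- Almost everywhere properties of the radius hold almost everywhere in the space. -/
theorem ae_norm_of_ae_Ioi {P : ℝ → Prop} (h : ∀ᵐ r ∂(volume.restrict (Ioi 0)), P r) :
    ∀ᵐ y : E, P ‖y‖ := by
  set N := toMeasurable (volume.restrict (Ioi (0 : ℝ))) {r | ¬ P r} with hN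
  have hN0 : volume.restrict (Ioi 0) N = 0 := by rw [hN, measure_toMeasurable]; exact h
  have hNm : MeasurableSet N := measurableSet_toMeasurable _ _
  have h1 := lintegral_radial_mul_polar (E := E) (f := fun _ => 1) measurable_const
    ((measurable_const (a := (1 : ℝ≥0∞))).indicator hNm)
  have h2 : ∫⁻ y : E, N.indicator (fun _ => (1 : ℝ≥0∞)) ‖y‖ * 1 = 0 := by
    rw [h1]
    refine (lintegral_congr_ae (g := fun _ => 0) ?_).trans (by simp)
    have : ∀ᵐ r ∂(volume.restrict (Ioi 0)), r ∉ N := measure_eq_zero_iff_ae_notMem.1 hN0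
    filter_upwards [this] with r hr
    simp [hr]
  have hNn : Measurable fun y : E => N.indicator (fun _ => (1 : ℝ≥0∞)) ‖y‖ :=
    ((measurable_const (a := (1 : ℝ≥0∞))).indicator hNm).comp measurable_norm
  simp only [mul_one] at h2
  rw [lintegral_eq_zero_iff hNn] at h2
  filter_upwards [h2] with y hy
  by_contra hP
  have : ‖y‖ ∈ N := subset_toMeasurable _ _ hP
  simp [this] at hy

/-- Invariance is inherited from Lebesgue measure: the integral over the unit ball of the
degree-zero extension `F (‖y‖⁻¹ • y)` is the spherical integral times a constant `c` that is
positive and finite, hence can be cancelled. -/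
theorem lintegral_sphere_comp_isometry {F : E → ℝ≥0∞} (hF : Measurable F) (L : E ≃ₗᵢ[ℝ] E) :
    ∫⁻ σ : Metric.sphere (0 : E) 1, F (L σ) ∂(volume : Measure E).toSphere =
      ∫⁻ σ : Metric.sphere (0 : E) 1, F σ ∂(volume : Measure E).toSphere := by
  set c : ℝ≥0∞ := ∫⁻ r in Ioo (0 : ℝ) 1, ENNReal.ofReal (r ^ (Module.finrank ℝ E - 1)) with hc
  have hc0 : c ≠ 0 := by
    rw [hc, ← pos_iff_ne_zero, setLIntegral_pos_iff (by fun_prop)]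
    have : Ioo (0 : ℝ) 1 ⊆ Function.support
        (fun r : ℝ => ENNReal.ofReal (r ^ (Module.finrank ℝ E - 1))) ∩ Ioo 0 1 := by
      intro r hr
      refine ⟨?_, hr⟩
      have : 0 < r ^ (Module.finrank ℝ E - 1) := pow_pos hr.1 _
      simpa using this
    exact lt_of_lt_of_le (by simp) (measure_mono this)
  have hct : c ≠ ⊤ := by
    refine ne_top_of_le_ne_top (b := ∫⁻ r in Ioo (0 : ℝ) 1, 1) (by simp) ?_
    refine setLIntegral_mono measurable_const fun r hr => ?_
    rw [ENNReal.ofReal_le_one]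
    exact pow_le_one₀ hr.1.le hr.2.le
  have key : ∀ H : E → ℝ≥0∞, Measurable H → ∫⁻ y in Metric.ball (0 : E) 1, H (‖y‖⁻¹ • y) =
      c * ∫⁻ σ : Metric.sphere (0 : E) 1, H σ ∂(volume : Measure E).toSphere := by
    intro H hH
    have := lintegral_ball_polar (E := E) (f := fun y => H (‖y‖⁻¹ • y)) (by
      apply hH.comp; fun_prop) (R := fun _ => 1) measurable_const 1
    simp only [one_mul] at this
    rw [this, hc, ← lintegral_mul_const _ (by fun_prop)]
    refine setLIntegral_congr_fun measurableSet_Ioo fun r hr => ?_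
    have hr' : r ≠ 0 := hr.1.ne'
    simp [norm_smul, abs_of_pos hr.1, smul_smul, hr']
  have h1 := key F hF
  have h2 := key (fun y => F (L y)) (hF.comp L.continuous.measurable)
  have h3 : ∫⁻ y in Metric.ball (0 : E) 1, F (L (‖y‖⁻¹ • y)) =
      ∫⁻ y in Metric.ball (0 : E) 1, F (‖y‖⁻¹ • y) := by
    have hmp := (L.measurePreserving).restrict_preimage
      (s := Metric.ball (0 : E) 1) Metric.isOpen_ball.measurableSet
    have hpre : L ⁻¹' (Metric.ball (0 : E) 1) = Metric.ball 0 1 := by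
      ext y; simp
    rw [hpre] at hmp
    have hm : Measurable fun y : E => F (‖y‖⁻¹ • y) := by apply hF.comp; fun_prop
    rw [← hmp.lintegral_comp hm]
    simp
  rw [h1, h2] at h3
  exact (ENNReal.mul_right_inj hc0 hct).1 h3

/-- A growth condition on balls controls the unweighted average over rays. -/
theorem lintegral_sphere_segment_le {G : E → ℝ≥0∞} (hG : Measurable G) {η : ℝ≥0∞}
    (h : ∀ b : ℝ, 0 < b → b ≤ 1 →
      ∫⁻ z in Metric.ball (0 : E) b, G z ≤ η * ENNReal.ofReal (b ^ Module.finrank ℝ E)) :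
    ∫⁻ s in Ioo (0 : ℝ) 1, ∫⁻ σ : Metric.sphere (0 : E) 1, G (s • (σ : E))
      ∂(volume : Measure E).toSphere ≤ 2 ^ Module.finrank ℝ E * η := by
  obtain ⟨m, hm⟩ : ∃ m, Module.finrank ℝ E = m + 1 :=
    Nat.exists_eq_succ_of_ne_zero (Module.finrank_pos (R := ℝ) (M := E)).ne'
  set Φ : ℝ → ℝ≥0∞ := fun s => ∫⁻ σ : Metric.sphere (0 : E) 1, G (s • (σ : E))
      ∂(volume : Measure E).toSphere with hΦ
  have hΦm : Measurable Φ := measurable_lintegral_sphere_smul hG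
  -- On the shell `(b / 2, b]` the Jacobian `s ^ m` is at least `(b / 2) ^ m`. Dividing the bound `η
  -- b ^ (m + 1)` by it leaves `2 ^ m η b`, which is summable over `b = 2 ^ (-k)`.
  have hcov : Ioo (0 : ℝ) 1 ⊆ ⋃ k : ℕ, Ioc ((1 / 2 : ℝ) ^ (k + 1)) ((1 / 2 : ℝ) ^ k) := by
    intro s hs
    obtain ⟨k, hk⟩ := exists_nat_pow_near_of_lt_one hs.1 hs.2.le (by norm_num : (0 : ℝ) < 1 / 2)
      (by norm_num)
    exact mem_iUnion.2 ⟨k, hk⟩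
  have hterm : ∀ k : ℕ, ∫⁻ s in Ioc ((1 / 2 : ℝ) ^ (k + 1)) ((1 / 2 : ℝ) ^ k), Φ s ≤
      2 ^ m * η * ENNReal.ofReal ((1 / 2) ^ k) := by
    intro k
    set b : ℝ := (1 / 2) ^ k with hb
    have hb0 : 0 < b := by positivity
    have hb1 : b ≤ 1 := pow_le_one₀ (by norm_num) (by norm_num)
    have hb2 : (1 / 2 : ℝ) ^ (k + 1) = b / 2 := by rw [pow_succ, hb]; ring
    have h1 := lintegral_ball_polar hG (R := fun _ => 1) measurable_const b
    have h2 := h b hb0 hb1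
    simp only [one_mul] at h1
    rw [h1, hm, Nat.add_sub_cancel] at h2
    rw [hb2]
    have h3 : ENNReal.ofReal ((b / 2) ^ m) * ∫⁻ s in Ioc (b / 2) b, Φ s ≤
        η * ENNReal.ofReal (b ^ (m + 1)) := by
      rw [← setLIntegral_congr Ioo_ae_eq_Ioc, ← lintegral_const_mul _ hΦm]
      refine le_trans ?_ h2
      refine le_trans ?_ (lintegral_mono_set (Ioo_subset_Ioo_left (by linarith : 0 ≤ b / 2)))
      refine setLIntegral_mono (by fun_prop) fun s hs => ?_
      gcongr
      exact hs.1.le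
    have h4 : (b ^ (m + 1)) = (b / 2) ^ m * (2 ^ m * b) := by
      rw [div_pow, pow_succ]; field_simp
    have h5 : ENNReal.ofReal ((b / 2) ^ m) ≠ 0 := by
      have : 0 < (b / 2) ^ m := by positivity
      simpa using this
    rw [h4, ENNReal.ofReal_mul (by positivity), ENNReal.ofReal_mul (by positivity),
      mul_left_comm] at h3
    have h6 := (ENNReal.mul_le_mul_iff_right h5 ENNReal.ofReal_ne_top).1 h3
    refine h6.trans (le_of_eq ?_)
    rw [ENNReal.ofReal_pow (by norm_num)]
    simp; ring
  calc ∫⁻ s in Ioo (0 : ℝ) 1, Φ s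
      ≤ ∫⁻ s in ⋃ k : ℕ, Ioc ((1 / 2 : ℝ) ^ (k + 1)) ((1 / 2 : ℝ) ^ k), Φ s :=
        lintegral_mono_set hcov
    _ ≤ ∑' k : ℕ, ∫⁻ s in Ioc ((1 / 2 : ℝ) ^ (k + 1)) ((1 / 2 : ℝ) ^ k), Φ s :=
        lintegral_iUnion_le _ _
    _ ≤ ∑' k : ℕ, 2 ^ m * η * ENNReal.ofReal ((1 / 2) ^ k) := ENNReal.tsum_le_tsum hterm
    _ = 2 ^ m * η * 2 := by
        rw [ENNReal.tsum_mul_left, ← ENNReal.ofReal_tsum_of_nonneg (fun k => by positivity)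
          summable_geometric_two, tsum_geometric_two]
        simp
    _ = _ := by rw [hm]; ring

/-- The growth hypothesis is scale invariant: for each radius `r < δ`, `z ↦ G (r • z)` satisfies it
on balls of radius at most 1 with the same `η`. The ray estimate thus applies on every sphere
separately, and the radial weight can be arbitrary. -/
theorem lintegral_radial_segment_le {G : E → ℝ≥0∞} (hG : Measurable G) {R : ℝ → ℝ≥0∞}
    (hR : Measurable R) {η : ℝ≥0∞} {δ : ℝ}
    (h : ∀ b ∈ Ioo 0 δ,
      ∫⁻ z in Metric.ball (0 : E) b, G z ≤ η * ENNReal.ofReal (b ^ Module.finrank ℝ E)) :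
    ∫⁻ y in Metric.ball (0 : E) δ, R ‖y‖ * ∫⁻ s in Ioo (0 : ℝ) 1, G (s • y) ≤
      2 ^ Module.finrank ℝ E * η *
        ∫⁻ r in Ioo 0 δ, R r * ENNReal.ofReal (r ^ (Module.finrank ℝ E - 1)) := by
  have hm : Measurable fun q : E × ℝ => G (q.2 • q.1) := by apply hG.comp; fun_prop
  rw [lintegral_ball_polar hm.lintegral_prod_right' hR,
    ← lintegral_const_mul _ (by fun_prop)]
  refine setLIntegral_mono (by fun_prop) fun r hr => ?_
  rw [mul_comm (2 ^ _ * η)]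
  gcongr
  have hr0 : 0 < r := hr.1
  rw [lintegral_lintegral_swap]
  swap
  · apply Measurable.aemeasurable
    apply hG.comp; fun_prop
  have := lintegral_sphere_segment_le (E := E) (G := fun z => G (r • z)) (η := η)
    (hG.comp (by fun_prop)) ?_
  · simpa only [smul_comm r] using this
  intro b hb0 hb1
  have h1 := h (b * r) ⟨by positivity, lt_of_le_of_lt (by nlinarith) hr.2⟩
  rw [← lintegral_indicator Metric.isOpen_ball.measurableSet] at h1 ⊢
  have h2 := lintegral_comp_smul (hG.indicator
    (Metric.isOpen_ball (x := (0 : E)) (ε := b * r)).measurableSet) hr0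
  have h3 : ∀ z : E, (Metric.ball (0 : E) (b * r)).indicator G (r • z) =
      (Metric.ball (0 : E) b).indicator (fun z => G (r • z)) z := by
    intro z
    have : r • z ∈ Metric.ball (0 : E) (b * r) ↔ z ∈ Metric.ball (0 : E) b := by
      simp only [mem_ball_zero_iff, norm_smul, Real.norm_eq_abs, abs_of_pos hr0]
      rw [mul_comm, mul_lt_mul_iff_left₀ hr0]
    by_cases hz : z ∈ Metric.ball (0 : E) b
    · rw [indicator_of_mem (this.2 hz), indicator_of_mem hz]
    · rw [indicator_of_notMem (fun h => hz (this.1 h)), indicator_of_notMem hz]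
  simp only [h3] at h2
  rw [h2]
  calc _ ≤ ENNReal.ofReal (r ^ Module.finrank ℝ E)⁻¹ *
        (η * ENNReal.ofReal ((b * r) ^ Module.finrank ℝ E)) := by gcongr
    _ = _ := by
      rw [mul_left_comm, ← ENNReal.ofReal_mul (by positivity), mul_pow]
      congr 2
      field_simp

end Polar

/-! ### The constant `γ_{d,p}`. -/

section Moment

variable {d : ℕ}

/-- The `p`-th moment of the unit sphere in the direction `a`. -/
theorem lintegral_sphere_inner_rpow {p : ℝ} (hp : 1 ≤ p)
    {e : EuclideanSpace ℝ (Fin d)} (he : ‖e‖ = 1) (a : EuclideanSpace ℝ (Fin d)) :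
    ∫⁻ σ : Metric.sphere (0 : EuclideanSpace ℝ (Fin d)) 1,
      ‖inner ℝ a (σ : EuclideanSpace ℝ (Fin d))‖ₑ ^ p
      ∂(volume : Measure (EuclideanSpace ℝ (Fin d))).toSphere =
      ENNReal.ofReal (gammaConst p e * ‖a‖ ^ p) := by
  have hp0 : 0 < p := by linarith
  have : Nontrivial (EuclideanSpace ℝ (Fin d)) := ⟨⟨e, 0, by rintro rfl; simp at he⟩⟩
  have hcont : Continuous fun σ : Metric.sphere (0 : EuclideanSpace ℝ (Fin d)) 1 =>
      |inner ℝ (σ : EuclideanSpace ℝ (Fin d)) e| ^ p := by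
    refine Continuous.rpow_const ?_ (fun _ => Or.inr hp0.le)
    fun_prop
  have h1 : ENNReal.ofReal (gammaConst p e) =
      ∫⁻ σ : Metric.sphere (0 : EuclideanSpace ℝ (Fin d)) 1,
      ‖inner ℝ e (σ : EuclideanSpace ℝ (Fin d))‖ₑ ^ p
      ∂(volume : Measure (EuclideanSpace ℝ (Fin d))).toSphere := by
    rw [gammaConst, ofReal_integral_eq_lintegral_ofReal]
    · refine lintegral_congr fun σ => ?_
      rw [← ENNReal.ofReal_rpow_of_nonneg (abs_nonneg _) hp0.le, real_inner_comm,
        ← Real.enorm_eq_ofReal_abs]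
    · exact hcont.integrable_of_hasCompactSupport (HasCompactSupport.of_compactSpace _)
    · exact Eventually.of_forall fun σ => by positivity
  -- Two vectors of equal norm are exchanged by a reflection, so rotation invariance reduces `a` to
  -- `‖a‖ • e`.
  obtain ⟨L, hL⟩ : ∃ L : EuclideanSpace ℝ (Fin d) ≃ₗᵢ[ℝ] EuclideanSpace ℝ (Fin d),
      L (‖a‖ • e) = a :=
    ⟨_, Submodule.reflection_sub (by simp [norm_smul, he])⟩
  have hmeas : Measurable fun y : EuclideanSpace ℝ (Fin d) => ‖inner ℝ a y‖ₑ ^ p := by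
    fun_prop
  rw [← lintegral_sphere_comp_isometry hmeas L, mul_comm, ENNReal.ofReal_mul (by positivity), h1,
    ← lintegral_const_mul _ (by fun_prop)]
  refine lintegral_congr fun σ => ?_
  nth_rewrite 1 [← hL]
  rw [L.inner_map_map, inner_smul_left, enorm_mul, ENNReal.mul_rpow_of_nonneg _ _ hp0.le,
    ← ENNReal.ofReal_rpow_of_nonneg (norm_nonneg _) hp0.le]
  simp

end Moment

/-! ### Increments of Sobolev functions as integrals of the weak gradient. -/

section Representation

theorem isOpen_setOf_segment_subset {E : Type*} [NormedAddCommGroup E] [NormedSpace ℝ E]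
    {Ω : Set E} (hΩ : IsOpen Ω) (h : E) :
    IsOpen {x : E | ∀ s ∈ Icc (0 : ℝ) 1, x + s • h ∈ Ω} := by
  rw [isOpen_iff_mem_nhds]
  intro x hx
  refine isCompact_Icc.eventually_forall_of_forall_eventually fun s hs => ?_
  have : Continuous fun q : E × ℝ => q.1 + q.2 • h := by fun_prop
  exact this.continuousAt.eventually_mem (hΩ.mem_nhds (hx s hs))

variable {d : ℕ} {Ω : Set (EuclideanSpace ℝ (Fin d))} {u : EuclideanSpace ℝ (Fin d) → ℝ}
  {g : EuclideanSpace ℝ (Fin d) → EuclideanSpace ℝ (Fin d)}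

theorem integrable_prod_inner_comp_add_smul (hgm : StronglyMeasurable g) (hg : Integrable g)
    (h : EuclideanSpace ℝ (Fin d)) :
    Integrable (fun q : EuclideanSpace ℝ (Fin d) × ℝ => inner ℝ (g (q.1 + q.2 • h)) h)
      (volume.prod (volume.restrict (Ioo (0 : ℝ) 1))) := by
  have hm : StronglyMeasurable fun q : EuclideanSpace ℝ (Fin d) × ℝ =>
      inner ℝ (g (q.1 + q.2 • h)) h := by
    refine StronglyMeasurable.inner (hgm.comp_measurable ?_) stronglyMeasurable_const
    fun_prop
  have hi : Integrable (fun x => inner ℝ (g x) h) := hg.inner_const h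
  rw [integrable_prod_iff' hm.aestronglyMeasurable]
  refine ⟨Eventually.of_forall fun s => hi.comp_add_right (s • h), ?_⟩
  have : ∀ s : ℝ, ∫ x, ‖inner ℝ (g (x + s • h)) h‖ = ∫ x, ‖inner ℝ (g x) h‖ := fun s =>
    integral_add_right_eq_self (fun x => ‖inner ℝ (g x) h‖) (s • h)
  simp only [this]
  exact integrable_const _

theorem HasWeakGradient.integral_eq_integral (hw : HasWeakGradient Ω u g)
    {φ : EuclideanSpace ℝ (Fin d) → ℝ} (hφ : ContDiff ℝ ∞ φ) (hc : HasCompactSupport φ)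
    (hs : tsupport φ ⊆ Ω) (v : EuclideanSpace ℝ (Fin d)) :
    ∫ x, u x * fderiv ℝ φ x v = - ∫ x, inner ℝ (g x) v * φ x := by
  have h0 : ∀ x, x ∉ Ω → φ x = 0 := fun x hx =>
    image_eq_zero_of_notMem_tsupport fun hx' => hx (hs hx')
  have h1 : ∀ x, x ∉ Ω → fderiv ℝ φ x = 0 := fun x hx =>
    image_eq_zero_of_notMem_tsupport fun hx' => hx (hs (tsupport_fderiv_subset ℝ hx'))
  have e1 := setIntegral_eq_integral_of_forall_compl_eq_zero (μ := volume) (s := Ω)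
    (f := fun x => u x * fderiv ℝ φ x v) fun x hx => by simp [h1 x hx]
  have e2 := setIntegral_eq_integral_of_forall_compl_eq_zero (μ := volume) (s := Ω)
    (f := fun x => inner ℝ (g x) v * φ x) fun x hx => by simp [h0 x hx]
  rw [← e1, ← e2]
  exact hw.integral_eq φ hφ hc hs v

/-- Fundamental theorem of calculus along almost every translate of a segment. -/
theorem HasWeakGradient.ae_sub_eq (hΩ : IsOpen Ω) (hw : HasWeakGradient Ω u g)
    (hu : Integrable u) (hgm : StronglyMeasurable g) (hg : Integrable g)
    (h : EuclideanSpace ℝ (Fin d)) :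
    ∀ᵐ x, (∀ s ∈ Icc (0 : ℝ) 1, x + s • h ∈ Ω) →
      u (x + h) - u x = ∫ s in Ioo (0 : ℝ) 1, inner ℝ (g (x + s • h)) h := by
  have hJ := integrable_prod_inner_comp_add_smul hgm hg h
  have hJi := hJ.integral_prod_left
  have hf : Integrable fun x => u (x + h) - u x -
      ∫ s in Ioo (0 : ℝ) 1, inner ℝ (g (x + s • h)) h :=
    ((hu.comp_add_right h).sub hu).sub hJi
  -- The identity is tested against `φ` supported where the whole segment stays in `Ω`. Every
  -- translate `φ (· - s • h)` is then an admissible test function for the weak gradient.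
  have key := (isOpen_setOf_segment_subset hΩ h).ae_eq_zero_of_integral_contDiff_smul_eq_zero
    (μ := volume) (hf.locallyIntegrable.locallyIntegrableOn _) ?_
  · filter_upwards [key] with x hx hxs
    exact sub_eq_zero.1 (hx hxs)
  intro φ hφ hc hs
  obtain ⟨C, hC⟩ := hc.exists_bound_of_continuous hφ.continuous
  have hdc : Continuous fun y => fderiv ℝ φ y h :=
    (hφ.continuous_fderiv (by simp)).clm_apply continuous_const
  obtain ⟨C', hC'⟩ := (hc.fderiv_apply (𝕜 := ℝ) h).exists_bound_of_continuous hdc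
  have hbd : ∀ {f : EuclideanSpace ℝ (Fin d) → ℝ}, Integrable f →
      Integrable fun x => φ x * f x := fun hf =>
    hf.bdd_mul hφ.continuous.aestronglyMeasurable (Eventually.of_forall hC)
  have e1 : ∫ x, φ x * u (x + h) = ∫ x, φ (x - h) * u x := by
    rw [← integral_add_right_eq_self (fun x => φ (x - h) * u x) h]
    simp
  have e2 : ∫ x, φ x * ∫ s in Ioo (0 : ℝ) 1, inner ℝ (g (x + s • h)) h =
      ∫ s in Ioo (0 : ℝ) 1, ∫ x, inner ℝ (g x) h * φ (x - s • h) := by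
    simp_rw [← integral_const_mul]
    rw [integral_integral_swap]
    · refine integral_congr_ae (Eventually.of_forall fun s => ?_)
      simp only
      rw [← integral_add_right_eq_self (fun x => inner ℝ (g x) h * φ (x - s • h)) (s • h)]
      refine integral_congr_ae (Eventually.of_forall fun x => ?_)
      simp [mul_comm]
    · exact hJ.bdd_mul (f := fun q : EuclideanSpace ℝ (Fin d) × ℝ => φ q.1)
        (hφ.continuous.comp continuous_fst).aestronglyMeasurable
        (Eventually.of_forall fun q => hC q.1)
  have e3 : ∀ s ∈ Ioo (0 : ℝ) 1, ∫ x, inner ℝ (g x) h * φ (x - s • h) =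
      - ∫ x, u x * fderiv ℝ φ (x - s • h) h := by
    intro s hs1
    have hφs : ContDiff ℝ ∞ fun x => φ (x - s • h) := hφ.comp (by fun_prop)
    have hts : tsupport (fun x => φ (x - s • h)) = (fun x => x - s • h) ⁻¹' tsupport φ :=
      tsupport_comp_eq_preimage φ (Homeomorph.subRight (s • h))
    have := hw.integral_eq_integral hφs
      (hc.comp_homeomorph (Homeomorph.subRight (s • h))) (by
        rw [hts]
        intro x hx
        have := hs hx s ⟨hs1.1.le, hs1.2.le⟩
        simpa using this) h
    have hfd : ∀ x, fderiv ℝ (fun x => φ (x - s • h)) x = fderiv ℝ φ (x - s • h) := fun x =>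
      fderiv_comp_sub (s • h)
    simp only [hfd] at this
    rw [this, neg_neg]
  -- The classical fundamental theorem of calculus, applied to the test function: the integrand is
  -- the `s`-derivative of `-φ (x - s • h)`.
  have e4 : ∫ s in Ioo (0 : ℝ) 1, ∫ x, u x * fderiv ℝ φ (x - s • h) h =
      ∫ x, u x * (φ x - φ (x - h)) := by
    rw [integral_integral_swap]
    · refine integral_congr_ae (Eventually.of_forall fun x => ?_)
      simp only
      rw [integral_const_mul]
      congr 1
      have hder : ∀ s : ℝ, HasDerivAt (fun s : ℝ => - φ (x - s • h))
          (fderiv ℝ φ (x - s • h) h) s := by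
        intro s
        have h1 : HasDerivAt (fun s : ℝ => x - s • h) (-h) s := by
          simpa using ((hasDerivAt_id s).smul_const h).const_sub x
        have h2 : HasFDerivAt φ (fderiv ℝ φ (x - s • h)) (x - s • h) :=
          (hφ.differentiable (by simp) _).hasFDerivAt
        simpa using! (h2.comp_hasDerivAt s h1).neg
      rw [← integral_Ioc_eq_integral_Ioo, ← intervalIntegral.integral_of_le zero_le_one,
        intervalIntegral.integral_eq_sub_of_hasDerivAt (fun s _ => hder s)]
      · simp; ring
      · exact (hdc.comp (by fun_prop)).intervalIntegrable _ _
    · have h1 : Integrable (fun q : ℝ × EuclideanSpace ℝ (Fin d) => u q.2)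
          ((volume.restrict (Ioo (0 : ℝ) 1)).prod volume) := hu.comp_snd _
      exact h1.mul_bdd (c := C') (hdc.comp (by fun_prop)).aestronglyMeasurable
        (Eventually.of_forall fun q => hC' _)
  simp only [smul_eq_mul, mul_sub]
  have e5 := integral_sub ((hbd (hu.comp_add_right h)).sub (hbd hu)) (hbd hJi)
  simp only [Pi.sub_apply] at e5
  rw [e5, integral_sub (hbd (hu.comp_add_right h)) (hbd hu), e1, e2,
    setIntegral_congr_fun measurableSet_Ioo e3, integral_neg, e4]
  have hb2 : Integrable fun x => φ (x - h) * u x :=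
    hu.bdd_mul (c := C) (hφ.continuous.comp (by fun_prop)).aestronglyMeasurable
      (Eventually.of_forall fun x => hC _)
  have : ∀ x, u x * (φ x - φ (x - h)) = φ x * u x - φ (x - h) * u x := fun x => by ring
  simp only [this]
  rw [integral_sub (hbd hu) hb2]
  ring

/-- The exceptional set does not depend on `a`. This allows both `a = g x`, for the linear
approximation, and `a = 0`, for the boundary estimate. -/
theorem HasWeakGradient.ae_enorm_sub_sub_inner_le (hΩ : IsOpen Ω) (hw : HasWeakGradient Ω u g)
    (hu : Integrable u) (hgm : StronglyMeasurable g) (hg : Integrable g)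
    (h : EuclideanSpace ℝ (Fin d)) :
    ∀ᵐ x, (∀ s ∈ Icc (0 : ℝ) 1, x + s • h ∈ Ω) → ∀ a : EuclideanSpace ℝ (Fin d),
      ‖u (x + h) - u x - inner ℝ a h‖ₑ ≤
        ‖h‖ₑ * ∫⁻ s in Ioo (0 : ℝ) 1, ‖g (x + s • h) - a‖ₑ := by
  filter_upwards [hw.ae_sub_eq hΩ hu hgm hg h,
    (integrable_prod_inner_comp_add_smul hgm hg h).prod_right_ae] with x hx hxi hxs a
  have h1 : u (x + h) - u x - inner ℝ a h =
      ∫ s in Ioo (0 : ℝ) 1, inner ℝ (g (x + s • h) - a) h := by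
    simp_rw [inner_sub_left]
    rw [integral_sub hxi (integrable_const _), hx hxs]
    simp
  have hm : Measurable fun s : ℝ => ‖g (x + s • h) - a‖ₑ := by
    refine ((hgm.measurable.comp ?_).sub_const a).enorm
    fun_prop
  rw [h1, ← lintegral_const_mul _ hm]
  refine (enorm_integral_le_lintegral_enorm _).trans (lintegral_mono fun s => ?_)
  rw [mul_comm]
  simp only [← ofReal_norm]
  rw [← ENNReal.ofReal_mul (norm_nonneg _)]
  exact ENNReal.ofReal_le_ofReal (norm_inner_le_norm _ _)

/-- Serves to replace an arbitrary weak gradient by the `p`-integrable one that membership in the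
Sobolev space provides. -/
theorem HasWeakGradient.ae_eq {g' : EuclideanSpace ℝ (Fin d) → EuclideanSpace ℝ (Fin d)}
    (hΩ : IsOpen Ω) (hw : HasWeakGradient Ω u g) (hw' : HasWeakGradient Ω u g') :
    g =ᵐ[volume.restrict Ω] g' := by
  have hloc : ∀ {f : EuclideanSpace ℝ (Fin d) → EuclideanSpace ℝ (Fin d)},
      LocallyIntegrableOn f Ω → ∀ v, LocallyIntegrableOn (fun x => inner ℝ (f x) v) Ω := by
    intro f hf v x hx
    obtain ⟨s, hs, hsi⟩ := hf x hx
    exact ⟨s, hs, Integrable.inner_const hsi v⟩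
  have key : ∀ v, ∀ᵐ x, x ∈ Ω → inner ℝ (g x) v - inner ℝ (g' x) v = 0 := by
    intro v
    have l1 := hloc hw.locallyIntegrableOn_grad v
    have l2 := hloc hw'.locallyIntegrableOn_grad v
    refine hΩ.ae_eq_zero_of_integral_contDiff_smul_eq_zero (l1.sub l2) fun φ hφ hc hs => ?_
    have hint : ∀ {f : EuclideanSpace ℝ (Fin d) → ℝ}, LocallyIntegrableOn f Ω →
        Integrable fun x => φ x * f x := by
      intro f hf
      have h1 : IntegrableOn f (tsupport φ) := hf.integrableOn_compact_subset hs hc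
      obtain ⟨C, hC⟩ := hc.exists_bound_of_continuous hφ.continuous
      have h2 : IntegrableOn (fun x => φ x * f x) (tsupport φ) :=
        h1.bdd_mul (c := C) hφ.continuous.aestronglyMeasurable (Eventually.of_forall hC)
      rwa [integrableOn_iff_integrable_of_support_subset] at h2
      intro x hx
      refine subset_tsupport _ ?_
      intro h0
      exact hx (by simp [h0])
    simp only [smul_eq_mul, mul_sub]
    rw [integral_sub (hint l1) (hint l2)]
    have e1 := hw.integral_eq_integral hφ hc hs v
    have e2 := hw'.integral_eq_integral hφ hc hs v
    simp only [mul_comm (φ _)]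
    linarith
  rw [EventuallyEq, ae_restrict_iff' hΩ.measurableSet]
  have h2 := ae_all_iff.2 fun i => key (EuclideanSpace.basisFun (Fin d) ℝ i)
  filter_upwards [h2] with x hx hxΩ
  ext i
  have := hx i hxΩ
  simp only [EuclideanSpace.basisFun_apply, EuclideanSpace.inner_single_right] at this
  simpa [sub_eq_zero] using this

end Representation

/-! ### Integrating a radial weight along transversal lines. -/

section Boundary

/-- Jensen's inequality for the power function. -/
theorem ENNReal.lintegral_rpow_le_measure_mul {α : Type*} [MeasurableSpace α] {μ : Measure α}
    [IsFiniteMeasure μ] {p : ℝ} (hp : 1 ≤ p) {f : α → ℝ≥0∞} (hf : AEMeasurable f μ) :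
    (∫⁻ a, f a ∂μ) ^ p ≤ μ univ ^ (p - 1) * ∫⁻ a, f a ^ p ∂μ := by
  have hp0 : 0 < p := by linarith
  have h := eLpNorm'_le_eLpNorm'_mul_rpow_measure_univ one_pos hp hf.aestronglyMeasurable
  simp only [eLpNorm', enorm_eq_self, ENNReal.rpow_one, div_one] at h
  have h2 := ENNReal.rpow_le_rpow h hp0.le
  rw [ENNReal.mul_rpow_of_nonneg _ _ hp0.le, ← ENNReal.rpow_mul, ← ENNReal.rpow_mul,
    one_div_mul_cancel hp0.ne', ENNReal.rpow_one, sub_mul, one_div_mul_cancel hp0.ne', one_mul] at h2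
  rwa [mul_comm]

theorem lintegral_Ioo_comp_mul {f : ℝ → ℝ≥0∞} (hf : Measurable f) {t : ℝ} (ht : 0 < t) :
    ENNReal.ofReal t * ∫⁻ s in Ioo (0 : ℝ) 1, f (s * t) = ∫⁻ s in Ioo 0 t, f s := by
  have h := lintegral_image_eq_lintegral_abs_deriv_mul (s := Ioo (0 : ℝ) 1)
    (f := fun s => s * t) (f' := fun _ => t) measurableSet_Ioo
    (fun s _ => by simpa using ((hasDerivAt_id s).mul_const t).hasDerivWithinAt)
    (fun a _ b _ hab => mul_right_cancel₀ ht.ne' hab) f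
  have himg : (fun s : ℝ => s * t) '' Ioo 0 1 = Ioo 0 t := by
    rw [image_mul_right_Ioo _ _ ht]; simp
  rw [himg, abs_of_pos ht] at h
  rw [h, lintegral_const_mul]
  exact hf.comp (by fun_prop)

variable {E : Type*} [NormedAddCommGroup E] [InnerProductSpace ℝ E]

/-- Change of variables along a line that meets spheres around the origin transversally. -/
theorem lintegral_norm_line_le (R : ℝ → ℝ≥0∞) {w v : E} {S : Set ℝ}
    (hS : MeasurableSet S) {κ r₀ D : ℝ} (hκ : κ ≠ 0) (hr₀ : 0 ≤ r₀)
    (h : ∀ t ∈ S, κ ^ 2 / 2 ≤ κ * inner ℝ (w + t • v) v ∧ r₀ < ‖w + t • v‖ ∧ ‖w + t • v‖ ≤ D) :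
    ∫⁻ t in S, R ‖w + t • v‖ ≤ ENNReal.ofReal (2 * D / |κ|) * ∫⁻ r in Ioi r₀, R r := by
  have hκ0 : 0 < |κ| := abs_pos.2 hκ
  have hκ2 : 0 < κ ^ 2 := by positivity
  have hpos : ∀ t ∈ S, 0 < ‖w + t • v‖ := fun t ht => hr₀.trans_lt (h t ht).2.1
  have hin : ∀ t ∈ S, |κ| / 2 ≤ |inner ℝ (w + t • v) v| := by
    intro t ht
    have h1 := (h t ht).1.trans (le_abs_self _)
    rw [abs_mul, ← sq_abs, sq] at h1
    have : |κ| * (|κ| / 2) ≤ |κ| * |inner ℝ (w + t • v) v| := by linarith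
    exact le_of_mul_le_mul_left this hκ0
  have hder : ∀ t ∈ S, HasDerivWithinAt (fun t : ℝ => ‖w + t • v‖)
      (inner ℝ (w + t • v) v / ‖w + t • v‖) S t := by
    intro t ht
    have h1 : HasDerivAt (fun t : ℝ => w + t • v) v t := by
      simpa using ((hasDerivAt_id t).smul_const v).const_add w
    have h2 := (h1.norm_sq).sqrt (by have := hpos t ht; positivity)
    simp only [Real.sqrt_sq (norm_nonneg _)] at h2
    rw [mul_div_mul_left _ _ two_ne_zero] at h2
    exact h2.hasDerivWithinAt
  -- The difference of the squared norms at `t` and `t'` is `t - t'` times a sum of two inner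
  -- products, both of the sign of `κ`, so the sum cannot vanish.
  have hinj : InjOn (fun t : ℝ => ‖w + t • v‖) S := by
    intro t ht t' ht' hEq
    have h1 : (t - t') * (inner ℝ (w + t • v) v + inner ℝ (w + t' • v) v) = 0 := by
      have h2 : ‖w + t • v‖ ^ 2 = ‖w + t' • v‖ ^ 2 := by
        simp only at hEq; rw [hEq]
      rw [← real_inner_self_eq_norm_sq, ← real_inner_self_eq_norm_sq] at h2
      simp only [inner_add_left, inner_add_right, inner_smul_left, inner_smul_right,
        RCLike.conj_to_real, real_inner_comm w v] at h2 ⊢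
      linarith
    rcases mul_eq_zero.1 h1 with h2 | h2
    · linarith
    · have h3 := (h t ht).1
      have h4 := (h t' ht').1
      have : κ * (inner ℝ (w + t • v) v + inner ℝ (w + t' • v) v) = 0 := by rw [h2, mul_zero]
      linarith
  have hcv := lintegral_image_eq_lintegral_abs_deriv_mul hS hder hinj R
  have hsub : (fun t : ℝ => ‖w + t • v‖) '' S ⊆ Ioi r₀ := by
    rintro _ ⟨t, ht, rfl⟩; exact (h t ht).2.1
  -- The derivative of the norm has absolute value at least `(|κ| / 2) / D`, whence the factor `2 *
  -- D / |κ|`.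
  calc ∫⁻ t in S, R ‖w + t • v‖
      ≤ ∫⁻ t in S, ENNReal.ofReal (2 * D / |κ|) *
          (ENNReal.ofReal |inner ℝ (w + t • v) v / ‖w + t • v‖| * R ‖w + t • v‖) := by
        refine setLIntegral_mono' hS fun t ht => ?_
        have hp := hpos t ht
        have hD := (h t ht).2.2
        rw [← mul_assoc, ← ENNReal.ofReal_mul (by have := hp.trans_le hD; positivity)]
        refine le_mul_of_one_le_left zero_le ?_
        rw [ENNReal.one_le_ofReal, abs_div, abs_norm, div_mul_div_comm, one_le_div (by positivity)]
        have := hin t ht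
        nlinarith
    _ = ENNReal.ofReal (2 * D / |κ|) * ∫⁻ r in (fun t : ℝ => ‖w + t • v‖) '' S, R r := by
        rw [hcv, lintegral_const_mul' _ _ ENNReal.ofReal_ne_top]
    _ ≤ _ := by gcongr

variable [FiniteDimensional ℝ E] [MeasurableSpace E] [BorelSpace E]

/-- With `z = y + t • v` as the new variable, the factor `H z` is independent of `t`, while `z - t •
v` runs along a line transversal to the spheres around `x`. The `t`-integral of the weight is then
bounded uniformly in `z`. -/
theorem lintegral_transversal_le {R : ℝ → ℝ≥0∞} (hR : Measurable R) {H : E → ℝ≥0∞}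
    (hH : Measurable H) {x v : E} {V : Set E} (hV : MeasurableSet V) {κ r₀ D : ℝ} (hκ : κ ≠ 0)
    (hr₀ : 0 ≤ r₀) (τ : ℝ)
    (h : ∀ y ∈ V, κ ^ 2 / 2 ≤ κ * inner ℝ (y - x) v ∧ r₀ < ‖y - x‖ ∧ ‖y - x‖ ≤ D) :
    ∫⁻ t in Ioo 0 τ, ∫⁻ y in V, R ‖y - x‖ * H (y + t • v) ≤
      ENNReal.ofReal (2 * D / |κ|) * (∫⁻ z, H z) * ∫⁻ r in Ioi r₀, R r := by
  have hRm : Measurable fun y : E => R ‖y - x‖ := hR.comp (by fun_prop)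
  have e1 : ∀ t : ℝ, ∫⁻ y in V, R ‖y - x‖ * H (y + t • v) =
      ∫⁻ z, V.indicator (fun y => R ‖y - x‖) (z - t • v) * H z := by
    intro t
    rw [← lintegral_add_right_eq_self
      (fun z => V.indicator (fun y => R ‖y - x‖) (z - t • v) * H z) (t • v),
      ← lintegral_indicator hV]
    refine lintegral_congr fun y => ?_
    by_cases hy : y ∈ V <;> simp [hy]
  simp_rw [e1]
  rw [lintegral_lintegral_swap]
  swap
  · apply Measurable.aemeasurable
    refine Measurable.mul ?_ (hH.comp measurable_snd)
    exact (hRm.indicator hV).comp (by fun_prop : Measurable fun q : ℝ × E => q.2 - q.1 • v)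
  have e2 : ∀ z : E, ∫⁻ t in Ioo 0 τ, V.indicator (fun y => R ‖y - x‖) (z - t • v) * H z ≤
      ENNReal.ofReal (2 * D / |κ|) * (∫⁻ r in Ioi r₀, R r) * H z := by
    intro z
    have hmz : Measurable fun t : ℝ => z - t • v := by fun_prop
    have hmi : Measurable fun t : ℝ => V.indicator (fun y => R ‖y - x‖) (z - t • v) :=
      (hRm.indicator hV).comp hmz
    rw [lintegral_mul_const _ hmi]
    gcongr
    have hSm : MeasurableSet ((fun t : ℝ => z - t • v) ⁻¹' V) := hmz hV
    have e3 : ∀ t : ℝ, V.indicator (fun y => R ‖y - x‖) (z - t • v) =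
        ((fun t : ℝ => z - t • v) ⁻¹' V).indicator (fun t => R ‖(z - x) + t • (-v)‖) t := by
      intro t
      have : z - t • v - x = z - x + t • -v := by rw [smul_neg]; abel
      simp only [indicator, mem_preimage, this]
      rfl
    simp_rw [e3]
    rw [lintegral_indicator hSm, Measure.restrict_restrict hSm]
    have := lintegral_norm_line_le R (w := z - x) (v := -v) (κ := -κ) (D := D)
      (hSm.inter (measurableSet_Ioo (a := 0) (b := τ))) (neg_ne_zero.2 hκ) hr₀ (fun t ht => by
        have h1 := h _ ht.1
        have : z - t • v - x = z - x + t • -v := by rw [smul_neg]; abel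
        rw [this] at h1
        simpa [inner_neg_right] using h1)
    simpa using this
  refine (lintegral_mono e2).trans (le_of_eq ?_)
  rw [lintegral_const_mul _ hH]
  ring

end Boundary

/-! ### Geometry of smooth domains. -/

section Domain

variable {d : ℕ} {Ω : Set (EuclideanSpace ℝ (Fin d))}

/-- Near each point of its closure a smooth domain is stable under small translations in some
direction transversal to the spheres around a given point. -/
theorem IsSmoothBoundedDomain.exists_transversal (hΩ : IsSmoothBoundedDomain Ω)
    {x y₀ : EuclideanSpace ℝ (Fin d)} (hy₀ : y₀ ∈ closure Ω) (hne : y₀ ≠ x) :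
    ∃ v : EuclideanSpace ℝ (Fin d), inner ℝ (y₀ - x) v ≠ 0 ∧
      ∀ᶠ q : EuclideanSpace ℝ (Fin d) × ℝ in 𝓝 (y₀, 0),
        q.1 ∈ Ω → 0 ≤ q.2 → q.1 + q.2 • v ∈ Ω := by
  have hcont : ∀ v : EuclideanSpace ℝ (Fin d), Tendsto
      (fun q : EuclideanSpace ℝ (Fin d) × ℝ => q.1 + q.2 • v) (𝓝 (y₀, 0)) (𝓝 y₀) := by
    intro v
    have : Continuous fun q : EuclideanSpace ℝ (Fin d) × ℝ => q.1 + q.2 • v := by fun_prop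
    simpa using this.tendsto (y₀, 0)
  have hne' : y₀ - x ≠ 0 := sub_ne_zero.2 hne
  by_cases hy : y₀ ∈ Ω
  · refine ⟨y₀ - x, by simpa using hne', ?_⟩
    filter_upwards [hcont (y₀ - x) (hΩ.isOpen.mem_nhds hy)] with q hq _ _ using hq
  obtain ⟨r, hr, e, he, γ, hγ, hγΩ⟩ := hΩ.smooth_boundary y₀
    ⟨hy₀, by rwa [hΩ.isOpen.interior_eq]⟩
  have hee : inner ℝ e e = (1 : ℝ) := by simp [he]
  set P : EuclideanSpace ℝ (Fin d) → EuclideanSpace ℝ (Fin d) :=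
    fun y => y - inner ℝ e y • e with hP
  have hPc : Continuous P := by fun_prop
  obtain ⟨K, T, hT, hK⟩ := (hγ.contDiffAt (x := P y₀)).of_le (by simp) |>.exists_lipschitzOnWith
  -- The second condition puts `v` in the cone above the graph of the `K`-Lipschitz function `γ`.
  -- The axis `e` lies in it; if `e` is tangent to the sphere around `x`, it is tilted towards `y₀ -
  -- x` by an amount `κ` so small that `K * κ * N ≤ 1`.
  obtain ⟨v, hv, hvK⟩ : ∃ v : EuclideanSpace ℝ (Fin d), inner ℝ (y₀ - x) v ≠ 0 ∧
      K * ‖P v‖ ≤ inner ℝ e v := by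
    by_cases h0 : inner ℝ (y₀ - x) e = 0
    · set N := ‖y₀ - x‖ with hN
      have hN0 : 0 < N := norm_pos_iff.2 hne'
      set κ : ℝ := 1 / ((K + 1) * (N + 1)) with hκ
      have hκ0 : 0 < κ := by positivity
      have h0' : inner ℝ e (y₀ - x) = 0 := by rw [real_inner_comm]; exact h0
      have hev : inner ℝ e (e + κ • (y₀ - x)) = 1 := by
        rw [inner_add_right, inner_smul_right, hee, h0']; simp
      refine ⟨e + κ • (y₀ - x), ?_, ?_⟩
      · rw [inner_add_right, inner_smul_right, h0, real_inner_self_eq_norm_sq, zero_add]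
        positivity
      · have : P (e + κ • (y₀ - x)) = κ • (y₀ - x) := by
          simp only [hP]; rw [hev]; simp
        rw [hev, this, norm_smul, Real.norm_eq_abs, abs_of_pos hκ0, ← hN, hκ, one_div,
          ← mul_assoc, mul_right_comm, ← div_eq_mul_inv, div_le_one (by positivity)]
        have : (0 : ℝ) ≤ K := K.2
        nlinarith
    · refine ⟨e, h0, ?_⟩
      have : P e = 0 := by simp only [hP]; rw [hee]; simp
      simp [this, he]
  refine ⟨v, hv, ?_⟩
  have hfst : Tendsto (fun q : EuclideanSpace ℝ (Fin d) × ℝ => q.1) (𝓝 (y₀, 0)) (𝓝 y₀) :=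
    continuous_fst.tendsto (y₀, (0 : ℝ))
  filter_upwards [hcont v (Metric.ball_mem_nhds y₀ hr), hfst (Metric.ball_mem_nhds y₀ hr),
    ((hPc.tendsto y₀).comp (hcont v)) hT, ((hPc.tendsto y₀).comp hfst) hT]
    with q h1 h2 h3 h4 hqΩ hq0
  have h5 := (hγΩ _ h2).1 hqΩ
  refine (hγΩ _ h1).2 ?_
  have h6 := hK.dist_le_mul _ h3 _ h4
  have h7 : P (q.1 + q.2 • v) - P q.1 = q.2 • P v := by
    simp only [hP, inner_add_right, inner_smul_right]
    module
  simp only [Function.comp] at h6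
  rw [dist_eq_norm (P _), h7, norm_smul, Real.norm_eq_abs, abs_of_nonneg hq0, Real.dist_eq] at h6
  have h8 := le_of_abs_le h6
  have h9 : q.2 * (K * ‖P v‖) ≤ q.2 * inner ℝ e v := by gcongr
  change γ (P (q.1 + q.2 • v)) < inner ℝ e (q.1 + q.2 • v)
  rw [inner_add_right, inner_smul_right]
  change γ (P q.1) < _ at h5
  linarith

end Domain

/-! ### Weighted `L^p` bounds up to the boundary. -/

section BoundaryEstimate

theorem lintegral_const_mul_add_const_mul {α : Type*} [MeasurableSpace α] {μ : Measure α}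
    {f h : α → ℝ≥0∞} (hf : Measurable f) (hh : Measurable h) (c a : ℝ≥0∞) :
    ∫⁻ x, c * (f x + a * h x) ∂μ = c * (∫⁻ x, f x ∂μ + a * ∫⁻ x, h x ∂μ) := by
  have hm : Measurable fun x => f x + a * h x := hf.add (hh.const_mul a)
  rw [lintegral_const_mul c hm, lintegral_add_left hf, lintegral_const_mul a hh]

variable {d : ℕ} {Ω : Set (EuclideanSpace ℝ (Fin d))} {u : EuclideanSpace ℝ (Fin d) → ℝ}
  {g : EuclideanSpace ℝ (Fin d) → EuclideanSpace ℝ (Fin d)}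

/-- Pointwise Sobolev estimate along almost every segment in direction `v`. -/
theorem HasWeakGradient.ae_enorm_rpow_le (hΩ : IsOpen Ω) (hw : HasWeakGradient Ω u g)
    (hu : Integrable u) (hgm : StronglyMeasurable g) (hg : Integrable g) {p : ℝ} (hp : 1 ≤ p)
    (v : EuclideanSpace ℝ (Fin d)) {t τ : ℝ} (ht : t ∈ Ioo 0 τ) :
    ∀ᵐ y, (∀ s ∈ Icc (0 : ℝ) τ, y + s • v ∈ Ω) →
      ‖u y‖ₑ ^ p ≤ 2 ^ (p - 1) * (‖u (y + t • v)‖ₑ ^ p + ‖v‖ₑ ^ p * ENNReal.ofReal τ ^ (p - 1) *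
        ∫⁻ s in Ioo 0 τ, ‖g (y + s • v)‖ₑ ^ p) := by
  have hp0 : 0 ≤ p := by linarith
  filter_upwards [hw.ae_enorm_sub_sub_inner_le hΩ hu hgm hg (t • v)] with y hy hyΩ
  have hgv : Measurable fun s : ℝ => ‖g (y + s • v)‖ₑ :=
    (hgm.measurable.comp (by fun_prop)).enorm
  have h1 := hy (fun s hs => by
    rw [smul_smul]
    exact hyΩ _ ⟨mul_nonneg hs.1 ht.1.le, by nlinarith [hs.1, hs.2, ht.1, ht.2]⟩) 0
  simp only [inner_zero_left, sub_zero, smul_smul] at h1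
  have h2 : ‖t • v‖ₑ * ∫⁻ s in Ioo (0 : ℝ) 1, ‖g (y + (s * t) • v)‖ₑ ≤
      ‖v‖ₑ * ∫⁻ s in Ioo 0 τ, ‖g (y + s • v)‖ₑ := by
    rw [enorm_smul, Real.enorm_eq_ofReal ht.1.le, mul_comm (ENNReal.ofReal t), mul_assoc,
      lintegral_Ioo_comp_mul hgv ht.1]
    gcongr
    exact ht.2.le
  have h3 : ‖u y‖ₑ ≤ ‖u (y + t • v)‖ₑ + ‖v‖ₑ * ∫⁻ s in Ioo 0 τ, ‖g (y + s • v)‖ₑ := by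
    calc ‖u y‖ₑ = ‖u (y + t • v) - (u (y + t • v) - u y)‖ₑ := by rw [sub_sub_cancel]
      _ ≤ ‖u (y + t • v)‖ₑ + ‖u (y + t • v) - u y‖ₑ := enorm_sub_le
      _ ≤ _ := by gcongr; exact h1.trans h2
  refine (ENNReal.rpow_le_rpow h3 hp0).trans ((ENNReal.rpow_add_le_mul_rpow_add_rpow _ _ hp).trans ?_)
  rw [ENNReal.mul_rpow_of_nonneg _ _ hp0, mul_assoc (‖v‖ₑ ^ p)]
  gcongr
  refine (ENNReal.lintegral_rpow_le_measure_mul hp hgv.aemeasurable).trans (le_of_eq ?_)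
  simp

/-- Local form, near a boundary point, of the estimate of `∫ |u|^p` against a radial weight. -/
theorem HasWeakGradient.lintegral_radial_le_of_translate (hΩ : IsOpen Ω)
    (hw : HasWeakGradient Ω u g) (hum : StronglyMeasurable u)
    (hu : Integrable u) (hgm : StronglyMeasurable g) (hg : Integrable g) {p : ℝ} (hp : 1 ≤ p)
    (hup : ∫⁻ z, ‖u z‖ₑ ^ p ≠ ⊤) (hgp : ∫⁻ z, ‖g z‖ₑ ^ p ≠ ⊤)
    {x v : EuclideanSpace ℝ (Fin d)} {V : Set (EuclideanSpace ℝ (Fin d))} (hV : MeasurableSet V)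
    {κ r₀ D τ : ℝ} (hκ : κ ≠ 0) (hr₀ : 0 ≤ r₀) (hτ : 0 < τ)
    (h : ∀ y ∈ V, κ ^ 2 / 2 ≤ κ * inner ℝ (y - x) v ∧ r₀ < ‖y - x‖ ∧ ‖y - x‖ ≤ D)
    (hVΩ : ∀ y ∈ V, ∀ s ∈ Icc (0 : ℝ) τ, y + s • v ∈ Ω) :
    ∃ C : ℝ≥0∞, C ≠ ⊤ ∧ ∀ R : ℝ → ℝ≥0∞, Measurable R →
      ∫⁻ y in V, ‖u y‖ₑ ^ p * R ‖y - x‖ ≤ C * ∫⁻ r in Ioi r₀, R r := by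
  have hp0 : 0 ≤ p := by linarith
  set A : ℝ≥0∞ := ‖v‖ₑ ^ p * ENNReal.ofReal τ ^ (p - 1) with hA
  have hAt : A ≠ ⊤ := by
    refine ENNReal.mul_ne_top (ENNReal.rpow_ne_top_of_nonneg hp0 enorm_ne_top)
      (ENNReal.rpow_ne_top_of_nonneg (by linarith) ENNReal.ofReal_ne_top)
  have h2t : (2 : ℝ≥0∞) ^ (p - 1) ≠ ⊤ :=
    ENNReal.rpow_ne_top_of_nonneg (by linarith) (by simp)
  have hU : Measurable fun z => ‖u z‖ₑ ^ p := hum.measurable.enorm.pow_const p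
  have hG : Measurable fun z => ‖g z‖ₑ ^ p := hgm.measurable.enorm.pow_const p
  -- The gradient term of the pointwise estimate is already an integral over `(0, τ)`, constant in
  -- `t`. Integrating over `t` multiplies it by `τ`, so the whole right-hand side becomes the
  -- `t`-integral of one function `H (y + t • v)`.
  set H : EuclideanSpace ℝ (Fin d) → ℝ≥0∞ := fun z =>
    2 ^ (p - 1) * (‖u z‖ₑ ^ p + A * ENNReal.ofReal τ * ‖g z‖ₑ ^ p) with hHdef
  have hH : Measurable H := (hU.add (hG.const_mul _)).const_mul _
  have hHt : ∫⁻ z, H z ≠ ⊤ := by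
    simp only [hHdef]
    rw [lintegral_const_mul_add_const_mul hU hG]
    exact ENNReal.mul_ne_top h2t (ENNReal.add_ne_top.2 ⟨hup,
      ENNReal.mul_ne_top (ENNReal.mul_ne_top hAt ENNReal.ofReal_ne_top) hgp⟩)
  have hτ0 : ENNReal.ofReal τ ≠ 0 := by simpa using hτ
  refine ⟨(ENNReal.ofReal τ)⁻¹ * (ENNReal.ofReal (2 * D / |κ|) * ∫⁻ z, H z),
    ENNReal.mul_ne_top (ENNReal.inv_ne_top.2 hτ0) (ENNReal.mul_ne_top ENNReal.ofReal_ne_top hHt),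
    fun R hR => ?_⟩
  have hRm : Measurable fun y : EuclideanSpace ℝ (Fin d) => R ‖y - x‖ := hR.comp (by fun_prop)
  have hUv : ∀ y, Measurable fun t : ℝ => ‖u (y + t • v)‖ₑ ^ p := fun y => hU.comp (by fun_prop)
  have hGv : ∀ y, Measurable fun t : ℝ => ‖g (y + t • v)‖ₑ ^ p := fun y => hG.comp (by fun_prop)
  have hU2 : Measurable fun q : ℝ × EuclideanSpace ℝ (Fin d) => ‖u (q.2 + q.1 • v)‖ₑ ^ p :=
    hU.comp (by fun_prop)
  have hG2 : Measurable fun q : EuclideanSpace ℝ (Fin d) × ℝ => ‖g (q.1 + q.2 • v)‖ₑ ^ p :=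
    hG.comp (by fun_prop)
  have hG3 : Measurable fun y => ∫⁻ s in Ioo 0 τ, ‖g (y + s • v)‖ₑ ^ p :=
    hG2.lintegral_prod_right'
  have key : ENNReal.ofReal τ * ∫⁻ y in V, ‖u y‖ₑ ^ p * R ‖y - x‖ ≤
      ENNReal.ofReal (2 * D / |κ|) * (∫⁻ z, H z) * ∫⁻ r in Ioi r₀, R r := by
    calc ENNReal.ofReal τ * ∫⁻ y in V, ‖u y‖ₑ ^ p * R ‖y - x‖
        = ∫⁻ _ in Ioo 0 τ, ∫⁻ y in V, ‖u y‖ₑ ^ p * R ‖y - x‖ := by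
          simp [mul_comm]
      _ ≤ ∫⁻ t in Ioo 0 τ, ∫⁻ y in V, R ‖y - x‖ * (2 ^ (p - 1) * (‖u (y + t • v)‖ₑ ^ p +
            A * ∫⁻ s in Ioo 0 τ, ‖g (y + s • v)‖ₑ ^ p)) := by
          refine setLIntegral_mono' measurableSet_Ioo fun t ht => ?_
          refine lintegral_mono_ae ?_
          rw [ae_restrict_iff' hV]
          filter_upwards [hw.ae_enorm_rpow_le hΩ hu hgm hg hp v ht] with y hy hyV
          rw [mul_comm]
          gcongr
          exact hy (hVΩ y hyV)
      _ = ∫⁻ y in V, ∫⁻ t in Ioo 0 τ, R ‖y - x‖ * (2 ^ (p - 1) * (‖u (y + t • v)‖ₑ ^ p +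
            A * ∫⁻ s in Ioo 0 τ, ‖g (y + s • v)‖ₑ ^ p)) := by
          rw [lintegral_lintegral_swap]
          apply Measurable.aemeasurable
          exact (hRm.comp measurable_snd).mul
            ((hU2.add ((hG3.comp measurable_snd).const_mul A)).const_mul _)
      _ = ∫⁻ y in V, ∫⁻ t in Ioo 0 τ, R ‖y - x‖ * H (y + t • v) := by
          refine lintegral_congr fun y => ?_
          have hHv : Measurable fun t : ℝ => H (y + t • v) := hH.comp (by fun_prop)
          have hm : Measurable fun t : ℝ => 2 ^ (p - 1) * (‖u (y + t • v)‖ₑ ^ p +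
              A * ∫⁻ s in Ioo 0 τ, ‖g (y + s • v)‖ₑ ^ p) :=
            ((hUv y).add measurable_const).const_mul _
          rw [lintegral_const_mul _ hm, lintegral_const_mul _ hHv,
            lintegral_const_mul_add_const_mul (hUv y) measurable_const]
          simp only [hHdef]
          rw [lintegral_const_mul_add_const_mul (hUv y) (hGv y), setLIntegral_const,
            Real.volume_Ioo, sub_zero]
          ring
      _ = ∫⁻ t in Ioo 0 τ, ∫⁻ y in V, R ‖y - x‖ * H (y + t • v) := by
          rw [lintegral_lintegral_swap]
          apply Measurable.aemeasurable
          exact (hRm.comp measurable_fst).mul (hH.comp (by fun_prop))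
      _ ≤ _ := lintegral_transversal_le hR hH hV hκ hr₀ τ h
  rw [mul_assoc]
  calc _ = (ENNReal.ofReal τ)⁻¹ * (ENNReal.ofReal τ * ∫⁻ y in V, ‖u y‖ₑ ^ p * R ‖y - x‖) := by
        rw [← mul_assoc, ENNReal.inv_mul_cancel hτ0 ENNReal.ofReal_ne_top, one_mul]
    _ ≤ _ := by gcongr

/-- The integral of `|u|^p` against a radial weight, away from the centre, is controlled by the
integral of the radial profile, up to the boundary of the domain. -/
theorem HasWeakGradient.exists_lintegral_radial_le (hΩ : IsSmoothBoundedDomain Ω)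
    (hw : HasWeakGradient Ω u g) (hum : StronglyMeasurable u)
    (hu : Integrable u) (hgm : StronglyMeasurable g) (hg : Integrable g) {p : ℝ} (hp : 1 ≤ p)
    (hup : ∫⁻ z, ‖u z‖ₑ ^ p ≠ ⊤) (hgp : ∫⁻ z, ‖g z‖ₑ ^ p ≠ ⊤)
    (x : EuclideanSpace ℝ (Fin d)) {r₀ δ : ℝ} (hr₀ : 0 ≤ r₀) (hδ : r₀ < δ) :
    ∃ C : ℝ≥0∞, C ≠ ⊤ ∧ ∀ R : ℝ → ℝ≥0∞, Measurable R →
      ∫⁻ y in Ω \ Metric.ball x δ, ‖u y‖ₑ ^ p * R ‖y - x‖ ≤ C * ∫⁻ r in Ioi r₀, R r := by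
  have hK : IsCompact (closure Ω \ Metric.ball x δ) :=
    (hΩ.isBounded.isCompact_closure).diff Metric.isOpen_ball
  suffices hS : ∃ C : ℝ≥0∞, C ≠ ⊤ ∧ ∀ R : ℝ → ℝ≥0∞, Measurable R →
      ∫⁻ y in Ω ∩ (closure Ω \ Metric.ball x δ), ‖u y‖ₑ ^ p * R ‖y - x‖ ≤
        C * ∫⁻ r in Ioi r₀, R r by
    have : Ω ∩ (closure Ω \ Metric.ball x δ) = Ω \ Metric.ball x δ := by
      ext y
      exact ⟨fun hy => ⟨hy.1, hy.2.2⟩, fun hy => ⟨hy.1, subset_closure hy.1, hy.2⟩⟩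
    rwa [this] at hS
  -- The property passes to subsets and finite unions, so it need only hold near each point of the
  -- compact set; the constant stays independent of `R`.
  refine hK.induction_on (p := fun S => ∃ C : ℝ≥0∞, C ≠ ⊤ ∧ ∀ R : ℝ → ℝ≥0∞, Measurable R →
      ∫⁻ y in Ω ∩ S, ‖u y‖ₑ ^ p * R ‖y - x‖ ≤ C * ∫⁻ r in Ioi r₀, R r) ?_ ?_ ?_ ?_
  · exact ⟨0, by simp, fun R _ => by simp⟩
  · rintro s t hst ⟨C, hC, h⟩
    exact ⟨C, hC, fun R hR => (lintegral_mono_set (inter_subset_inter_right _ hst)).trans (h R hR)⟩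
  · rintro s t ⟨C, hC, h⟩ ⟨C', hC', h'⟩
    refine ⟨C + C', ENNReal.add_ne_top.2 ⟨hC, hC'⟩, fun R hR => ?_⟩
    rw [inter_union_distrib_left, add_mul]
    exact (lintegral_union_le _ _ _).trans (add_le_add (h R hR) (h' R hR))
  intro y₀ hy₀
  have hyx : r₀ < ‖y₀ - x‖ := by
    have := hy₀.2
    rw [Metric.mem_ball, not_lt, dist_eq_norm] at this
    linarith
  have hne : y₀ ≠ x := by
    rintro rfl
    simp at hyx; linarith
  obtain ⟨v, hv, hev⟩ := hΩ.exists_transversal hy₀.1 hne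
  set κ : ℝ := inner ℝ (y₀ - x) v with hκ
  have hκ2 : 0 < κ ^ 2 := by positivity
  have ev1 : ∀ᶠ y in 𝓝 y₀, κ ^ 2 / 2 < κ * inner ℝ (y - x) v := by
    have hc : Continuous fun y : EuclideanSpace ℝ (Fin d) => κ * inner ℝ (y - x) v := by fun_prop
    exact hc.continuousAt.eventually (lt_mem_nhds (by change _ < κ * κ; nlinarith))
  have hcn : Continuous fun y : EuclideanSpace ℝ (Fin d) => ‖y - x‖ := by fun_prop
  have ev2 : ∀ᶠ y in 𝓝 y₀, r₀ < ‖y - x‖ := hcn.continuousAt.eventually (lt_mem_nhds hyx)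
  have ev3 : ∀ᶠ y in 𝓝 y₀, ‖y - x‖ < ‖y₀ - x‖ + 1 :=
    hcn.continuousAt.eventually (gt_mem_nhds (by linarith))
  obtain ⟨s₁, hs₁, h₁⟩ := Metric.eventually_nhds_iff.1 (ev1.and (ev2.and ev3))
  obtain ⟨s₂, hs₂, h₂⟩ := Metric.eventually_nhds_iff.1 hev
  have hs : 0 < min s₁ s₂ := lt_min hs₁ hs₂
  refine ⟨Metric.ball y₀ (min s₁ s₂), mem_nhdsWithin_of_mem_nhds (Metric.ball_mem_nhds _ hs), ?_⟩
  refine hw.lintegral_radial_le_of_translate hΩ.isOpen hum hu hgm hg hp hup hgp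
    (v := v) (κ := κ) (D := ‖y₀ - x‖ + 1) (τ := s₂ / 2)
    (hΩ.isOpen.inter Metric.isOpen_ball).measurableSet hv hr₀ (by positivity) ?_ ?_
  · rintro y ⟨_, hy⟩
    obtain ⟨a, b, c⟩ := h₁ (lt_of_lt_of_le hy (min_le_left _ _))
    exact ⟨a.le, b, c.le⟩
  · rintro y ⟨hyΩ, hy⟩ s hs'
    refine h₂ (y := (y, s)) ?_ hyΩ hs'.1
    rw [Prod.dist_eq, max_lt_iff]
    refine ⟨lt_of_lt_of_le hy (min_le_right _ _), ?_⟩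
    simp only [Real.dist_eq, sub_zero]
    rw [abs_of_nonneg hs'.1]
    linarith [hs'.2]

end BoundaryEstimate

/-! ### Comparison with a model, and Lebesgue points. -/

section Approximation

/-- `A` and `B` may depend on `ε`: they are the contributions of the model near the centre and of
the far region, for a splitting radius chosen after `ε`. -/
theorem ENNReal.tendsto_of_forall_exists_approx {N : ℕ → ℝ≥0∞} {ℓ : ℝ≥0∞} (hℓ : ℓ ≠ ⊤)
    (h : ∀ ε : ℝ≥0∞, ε ≠ 0 → ∃ A B : ℕ → ℝ≥0∞, Tendsto A atTop (𝓝 ℓ) ∧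
      Tendsto B atTop (𝓝 0) ∧ ∀ n, N n ≤ A n + ε + B n ∧ A n ≤ N n + ε) :
    Tendsto N atTop (𝓝 ℓ) := by
  rw [ENNReal.tendsto_nhds hℓ]
  intro ε hε
  have hε3 : ε / 3 ≠ 0 := (ENNReal.div_pos hε.ne' (by simp)).ne'
  obtain ⟨A, B, hA, hB, hN⟩ := h (ε / 3) hε3
  filter_upwards [(ENNReal.tendsto_nhds hℓ).1 hA _ (pos_iff_ne_zero.2 hε3),
    (ENNReal.tendsto_nhds_zero.1 hB) _ (pos_iff_ne_zero.2 hε3)] with n hAn hBn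
  obtain ⟨h1, h2⟩ := hN n
  have h3 : ε / 3 + ε / 3 + ε / 3 = ε := ENNReal.add_thirds ε
  constructor
  · rw [tsub_le_iff_right]
    calc ℓ ≤ A n + ε / 3 := tsub_le_iff_right.1 hAn.1
      _ ≤ N n + ε / 3 + ε / 3 := by gcongr
      _ ≤ N n + ε / 3 + ε / 3 + ε / 3 := le_self_add
      _ = N n + (ε / 3 + ε / 3 + ε / 3) := by ring
      _ = N n + ε := by rw [h3]
  · calc N n ≤ A n + ε / 3 + B n := h1
      _ ≤ (ℓ + ε / 3) + ε / 3 + ε / 3 := by gcongr; exact hAn.2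
      _ = ℓ + (ε / 3 + ε / 3 + ε / 3) := by ring
      _ = ℓ + ε := by rw [h3]

variable {E : Type*} [NormedAddCommGroup E] [InnerProductSpace ℝ E] [FiniteDimensional ℝ E]
  [MeasurableSpace E] [BorelSpace E]

/-- Reduction of the limit of `∫ q^p` against concentrating radial weights to a homogeneous model
`l` of `q` near the origin. -/
theorem tendsto_lintegral_rpow_mul_radial {p : ℝ} (hp : 1 ≤ p) {W : Set E} (hW : MeasurableSet W)
    {R : ℕ → ℝ → ℝ≥0∞} (hR : ∀ n, Measurable (R n)) {q l : E → ℝ≥0∞} (hq : Measurable q)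
    (hl : Measurable l) {K : ℝ≥0∞} (hK : K ≠ ⊤)
    (hlim : ∀ δ : ℝ, 0 < δ →
      Tendsto (fun n => ∫⁻ z in Metric.ball (0 : E) δ, R n ‖z‖ * l z ^ p) atTop (𝓝 K))
    (htail : ∀ δ : ℝ, 0 < δ →
      Tendsto (fun n => ∫⁻ z in W \ Metric.ball (0 : E) δ, R n ‖z‖ * q z ^ p) atTop (𝓝 0))
    (hnear : ∀ ε : ℝ≥0∞, ε ≠ 0 → ∃ δ : ℝ, 0 < δ ∧ Metric.ball (0 : E) δ ⊆ W ∧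
      ∃ m : E → ℝ≥0∞, Measurable m ∧
        (∀ᵐ z, z ∈ Metric.ball (0 : E) δ → q z ≤ l z + m z ∧ l z ≤ q z + m z) ∧
        ∀ n, ∫⁻ z in Metric.ball (0 : E) δ, R n ‖z‖ * m z ^ p ≤ ε) :
    Tendsto (fun n => ∫⁻ z in W, R n ‖z‖ * q z ^ p) atTop (𝓝 K) := by
  have hp0 : 0 < p := by linarith
  have hRn : ∀ n, Measurable fun z : E => R n ‖z‖ := fun n => (hR n).comp measurable_norm
  -- Taking `p`-th roots turns the integrals into `L^p` norms for the weight, to which Minkowski's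
  -- inequality applies. The local error is accordingly requested at size `ε ^ p`.
  suffices h : Tendsto (fun n => (∫⁻ z in W, R n ‖z‖ * q z ^ p) ^ (1 / p)) atTop
      (𝓝 (K ^ (1 / p))) by
    have h2 := h.ennrpow_const p
    simpa only [← ENNReal.rpow_mul, one_div_mul_cancel hp0.ne', ENNReal.rpow_one] using h2
  refine ENNReal.tendsto_of_forall_exists_approx
    (ENNReal.rpow_ne_top_of_nonneg (by positivity) hK) fun ε hε => ?_
  obtain ⟨δ, hδ, hball, m, hm, hae, hmε⟩ := hnear (ε ^ p) (by simp [hp0, hε, hp0.le])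
  set B := Metric.ball (0 : E) δ with hBdef
  have hBm : MeasurableSet B := Metric.isOpen_ball.measurableSet
  refine ⟨fun n => (∫⁻ z in B, R n ‖z‖ * l z ^ p) ^ (1 / p),
    fun n => (∫⁻ z in W \ B, R n ‖z‖ * q z ^ p) ^ (1 / p),
    (hlim δ hδ).ennrpow_const _, ?_, fun n => ?_⟩
  · have := (htail δ hδ).ennrpow_const (1 / p)
    rwa [ENNReal.zero_rpow_of_pos (by positivity)] at this
  set μ : Measure E := (volume.restrict W).withDensity fun z => R n ‖z‖ with hμ
  have hind : ∀ (f : E → ℝ≥0∞), Measurable f → ∀ S : Set E, MeasurableSet S → S ⊆ W →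
      ∫⁻ z, (S.indicator f z) ^ p ∂μ = ∫⁻ z in S, R n ‖z‖ * f z ^ p := by
    intro f hf S hS hSW
    rw [hμ, lintegral_withDensity_eq_lintegral_mul _ (hRn n) ((hf.indicator hS).pow_const p),
      ← inter_eq_self_of_subset_left hSW, ← Measure.restrict_restrict hS,
      ← lintegral_indicator hS, inter_eq_self_of_subset_left hSW]
    refine lintegral_congr fun z => ?_
    by_cases hz : z ∈ S <;> simp [hz, hp0]
  have hae' : ∀ᵐ z ∂μ, z ∈ B → q z ≤ l z + m z ∧ l z ≤ q z + m z :=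
    (withDensity_absolutelyContinuous _ _).ae_le (ae_restrict_of_ae hae)
  have haeW : ∀ᵐ z ∂μ, z ∈ W :=
    (withDensity_absolutelyContinuous _ _).ae_le (ae_restrict_mem hW)
  have eq1 := hind q hq W hW subset_rfl
  have eq2 := hind l hl B hBm hball
  have eq3 := hind m hm B hBm hball
  have eq4 := hind q hq (W \ B) (hW.diff hBm) sdiff_subset
  have hM : (∫⁻ z, (B.indicator m z) ^ p ∂μ) ^ (1 / p) ≤ ε := by
    rw [eq3]
    calc _ ≤ (ε ^ p) ^ (1 / p) := ENNReal.rpow_le_rpow (hmε n) (by positivity)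
      _ = ε := by rw [← ENNReal.rpow_mul, mul_one_div_cancel hp0.ne', ENNReal.rpow_one]
  have mink : ∀ f g h : E → ℝ≥0∞, Measurable g → Measurable h →
      (∀ᵐ z ∂μ, f z ≤ g z + h z) → (∫⁻ z, f z ^ p ∂μ) ^ (1 / p) ≤
        (∫⁻ z, g z ^ p ∂μ) ^ (1 / p) + (∫⁻ z, h z ^ p ∂μ) ^ (1 / p) := by
    intro f g h hg hh hfgh
    refine le_trans ?_ (ENNReal.lintegral_Lp_add_le hg.aemeasurable hh.aemeasurable hp)
    refine ENNReal.rpow_le_rpow (lintegral_mono_ae ?_) (by positivity)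
    filter_upwards [hfgh] with z hz using ENNReal.rpow_le_rpow hz hp0.le
  simp only [← eq1, ← eq2, ← eq4]
  constructor
  · refine (mink _ (B.indicator l + B.indicator m) ((W \ B).indicator q)
      ((hl.indicator hBm).add (hm.indicator hBm)) (hq.indicator (hW.diff hBm)) ?_).trans ?_
    · filter_upwards [hae', haeW] with z hz hzW
      by_cases hzB : z ∈ B
      · simpa [hzB, hzW] using (hz hzB).1
      · simp [hzB, hzW]
    · gcongr
      refine (mink _ _ _ (hl.indicator hBm) (hm.indicator hBm)
        (Eventually.of_forall fun z => le_rfl)).trans ?_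
      gcongr
  · refine (mink _ (W.indicator q) (B.indicator m) (hq.indicator hW) (hm.indicator hBm) ?_).trans ?_
    · filter_upwards [hae', haeW] with z hz hzW
      by_cases hzB : z ∈ B
      · simpa [hzB, hzW] using (hz hzB).2
      · simp [hzB]
    · gcongr

/-- Almost every point is a Lebesgue point of order `p`. -/
theorem ae_lintegral_ball_rpow_sub_le {F : Type*} [NormedAddCommGroup F]
    [MeasurableSpace F] [BorelSpace F] [SecondCountableTopology F] {Ω : Set E} (hΩ : IsOpen Ω)
    (hΩf : volume Ω ≠ ⊤) {g : E → F} (hg : Measurable g) {p : ℝ} (hp : 1 ≤ p)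
    (hgp : ∫⁻ z, ‖g z‖ₑ ^ p ≠ ⊤) :
    ∀ᵐ x, x ∈ Ω → ∀ ε : ℝ≥0∞, ε ≠ 0 → ∃ δ : ℝ, 0 < δ ∧ ∀ b ∈ Ioo 0 δ,
      ∫⁻ z in Metric.ball (0 : E) b, ‖g (x + z) - g x‖ₑ ^ p ≤
        ε * ENNReal.ofReal (b ^ Module.finrank ℝ E) := by
  have hp0 : 0 < p := by linarith
  have h2t : (2 : ℝ≥0∞) ^ (p - 1) ≠ ⊤ := ENNReal.rpow_ne_top_of_nonneg (by linarith) (by simp)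
  have hsub : ∀ a b c : F, ‖a - c‖ₑ ^ p ≤ 2 ^ (p - 1) * (‖a - b‖ₑ ^ p + ‖c - b‖ₑ ^ p) := by
    intro a b c
    refine (ENNReal.rpow_le_rpow ?_ hp0.le).trans (ENNReal.rpow_add_le_mul_rpow_add_rpow _ _ hp)
    calc ‖a - c‖ₑ = ‖(a - b) - (c - b)‖ₑ := by rw [sub_sub_sub_cancel_right]
      _ ≤ _ := enorm_sub_le
  have hm : ∀ c : F, Measurable fun z => ‖g z - c‖ₑ ^ p := fun c =>
    (hg.sub_const c).enorm.pow_const p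
  have hfin : ∀ c : F, ∫⁻ z, Ω.indicator (fun z => ‖g z - c‖ₑ ^ p) z ≠ ⊤ := by
    intro c
    rw [lintegral_indicator hΩ.measurableSet]
    refine ne_top_of_le_ne_top (b := ∫⁻ z in Ω, 2 ^ (p - 1) * (‖g z‖ₑ ^ p + ‖c‖ₑ ^ p)) ?_
      (lintegral_mono fun z => by simpa using hsub (g z) 0 c)
    have hgm : Measurable fun z => ‖g z‖ₑ ^ p := hg.enorm.pow_const p
    rw [lintegral_const_mul' _ _ h2t, lintegral_add_left hgm, setLIntegral_const]
    exact ENNReal.mul_ne_top h2t (ENNReal.add_ne_top.2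
      ⟨ne_top_of_le_ne_top hgp (setLIntegral_le_lintegral _ _),
        ENNReal.mul_ne_top (ENNReal.rpow_ne_top_of_nonneg hp0.le enorm_ne_top) hΩf⟩)
  -- Differentiation is applied to `‖g - c‖ ^ p` for `c` in a countable dense set, giving one null
  -- set for all `c`; `g x` is approximated by such a `c` afterwards. The indicator of `Ω`, of
  -- finite measure, makes these functions integrable.
  have key := ae_all_iff.2 fun k : ℕ =>
    (Besicovitch.vitaliFamily (volume : Measure E)).ae_tendsto_lintegral_div
      ((hm (TopologicalSpace.denseSeq F k)).indicator hΩ.measurableSet).aemeasurable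
      (hfin (TopologicalSpace.denseSeq F k))
  filter_upwards [key] with x hx hxΩ ε hε
  set w : ℝ≥0∞ := volume (Metric.ball (0 : E) 1) with hw
  have hw0 : w ≠ 0 := (Metric.measure_ball_pos _ _ one_pos).ne'
  have hwt : w ≠ ⊤ := measure_ball_lt_top.ne
  -- Convexity of the power gives `2 ^ (p - 1)`, the terms `g z - c` and `g x - c` give 2, and the
  -- volume of the ball gives `w`.
  set M : ℝ≥0∞ := 2 ^ (p - 1) * 2 * w with hM
  have hMt : M ≠ ⊤ := ENNReal.mul_ne_top (ENNReal.mul_ne_top h2t (by simp)) hwt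
  set η := ε / M with hη
  have hη0 : η ≠ 0 := (ENNReal.div_pos hε hMt).ne'
  obtain ⟨k, hk⟩ : ∃ k, ‖g x - TopologicalSpace.denseSeq F k‖ₑ ^ p < η := by
    have hc : Continuous fun c : F => ‖g x - c‖ₑ ^ p :=
      ENNReal.continuous_rpow_const.comp (continuous_enorm.comp (by fun_prop))
    exact (TopologicalSpace.denseRange_denseSeq F).exists_mem_open
      (isOpen_lt hc continuous_const) ⟨g x, by simpa [hp0] using pos_iff_ne_zero.2 hη0⟩
  set c := TopologicalSpace.denseSeq F k with hcdef
  have h1 := (hx k).comp (Besicovitch.tendsto_filterAt (volume : Measure E) x)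
  rw [indicator_of_mem hxΩ] at h1
  obtain ⟨δ₁, hδ₁, h2⟩ := mem_nhdsGT_iff_exists_Ioo_subset.1 (h1.eventually (gt_mem_nhds hk))
  obtain ⟨δ₂, hδ₂, hball⟩ := Metric.isOpen_iff.1 hΩ x hxΩ
  refine ⟨min δ₁ δ₂, lt_min hδ₁ hδ₂, fun b hb => ?_⟩
  have h3 := h2 ⟨hb.1, hb.2.trans_le (min_le_left _ _)⟩
  have hvol : volume (Metric.closedBall x b) = ENNReal.ofReal (b ^ Module.finrank ℝ E) * w :=
    Measure.addHaar_closedBall _ _ hb.1.le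
  have hvol0 : volume (Metric.closedBall x b) ≠ 0 := (Metric.measure_closedBall_pos _ _ hb.1).ne'
  have hvolt : volume (Metric.closedBall x b) ≠ ⊤ := measure_closedBall_lt_top.ne
  have h4 : ∫⁻ z in Metric.closedBall x b, Ω.indicator (fun z => ‖g z - c‖ₑ ^ p) z ≤
      η * (ENNReal.ofReal (b ^ Module.finrank ℝ E) * w) := by
    rw [← hvol]
    exact (ENNReal.div_le_iff hvol0 hvolt).1 (le_of_lt h3)
  have h5 : ∫⁻ z in Metric.ball (0 : E) b, ‖g (x + z) - g x‖ₑ ^ p =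
      ∫⁻ z in Metric.ball x b, ‖g z - g x‖ₑ ^ p := by
    rw [← lintegral_indicator Metric.isOpen_ball.measurableSet,
      ← lintegral_indicator Metric.isOpen_ball.measurableSet,
      ← lintegral_add_left_eq_self
        (fun z => (Metric.ball x b).indicator (fun z => ‖g z - g x‖ₑ ^ p) z) x]
    refine lintegral_congr fun z => ?_
    by_cases hz : ‖z‖ < b <;> simp [hz, indicator]
  have h6 : ∫⁻ z in Metric.ball x b, ‖g z - c‖ₑ ^ p ≤
      η * (ENNReal.ofReal (b ^ Module.finrank ℝ E) * w) := by
    refine le_trans ?_ h4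
    refine le_trans ?_ (lintegral_mono_set Metric.ball_subset_closedBall)
    refine setLIntegral_mono' Metric.isOpen_ball.measurableSet fun z hz => ?_
    rw [indicator_of_mem (hball (Metric.ball_subset_ball (hb.2.le.trans (min_le_right _ _)) hz))]
  rw [h5]
  calc ∫⁻ z in Metric.ball x b, ‖g z - g x‖ₑ ^ p
      ≤ ∫⁻ z in Metric.ball x b, 2 ^ (p - 1) * (‖g z - c‖ₑ ^ p + ‖g x - c‖ₑ ^ p) :=
        lintegral_mono fun z => hsub _ _ _
    _ ≤ 2 ^ (p - 1) * (η * (ENNReal.ofReal (b ^ Module.finrank ℝ E) * w) +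
          η * (ENNReal.ofReal (b ^ Module.finrank ℝ E) * w)) := by
        rw [lintegral_const_mul' _ _ h2t, lintegral_add_left (hm c), setLIntegral_const,
          Measure.addHaar_ball_of_pos _ _ hb.1]
        gcongr
    _ = M * η * ENNReal.ofReal (b ^ Module.finrank ℝ E) := by rw [hM]; ring
    _ ≤ _ := by gcongr; exact ENNReal.mul_div_le

end Approximation

/-! ### Limit of the weighted difference quotients. -/

section DifferenceQuotient

theorem setLIntegral_preimage_add_left {E : Type*} [NormedAddCommGroup E] [MeasurableSpace E]
    [BorelSpace E] {μ : Measure E} [μ.IsAddLeftInvariant] {S : Set E} (hS : MeasurableSet S)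
    (F : E → ℝ≥0∞) (x : E) :
    ∫⁻ z in (fun z => x + z) ⁻¹' S, F (x + z) ∂μ = ∫⁻ y in S, F y ∂μ := by
  rw [← lintegral_indicator hS, ← lintegral_indicator ((measurable_const_add x) hS),
    ← lintegral_add_left_eq_self (S.indicator F) x]
  rfl

variable {d : ℕ} {Ω : Set (EuclideanSpace ℝ (Fin d))} {u : EuclideanSpace ℝ (Fin d) → ℝ}
  {g : EuclideanSpace ℝ (Fin d) → EuclideanSpace ℝ (Fin d)}

/-- Fubini exchanges "for every `z`, almost every `x`" for "almost every `x`, almost every `z`". The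
distance condition forces the segment into `Ω` and is jointly measurable, as the exchange requires.
-/
theorem HasWeakGradient.ae_ae_enorm_sub_sub_inner_le (hΩ : IsOpen Ω) (hw : HasWeakGradient Ω u g)
    (hum : StronglyMeasurable u) (hu : Integrable u) (hgm : StronglyMeasurable g)
    (hg : Integrable g) :
    ∀ᵐ x, ∀ᵐ z, ‖z‖ₑ < Metric.infEDist x Ωᶜ →
      ‖u (x + z) - u x - inner ℝ (g x) z‖ₑ ≤
        ‖z‖ₑ * ∫⁻ s in Ioo (0 : ℝ) 1, ‖g (x + s • z) - g x‖ₑ := by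
  have hum' := hum.measurable
  have hgm' := hgm.measurable
  rw [Measure.ae_ae_comm]
  · refine Eventually.of_forall fun z => ?_
    filter_upwards [hw.ae_enorm_sub_sub_inner_le hΩ hu hgm hg z] with x hx hz
    refine hx (fun s hs => ?_) (g x)
    by_contra hns
    have h1 := Metric.infEDist_le_edist_of_mem (x := x) (mem_compl hns)
    have h2 : edist x (x + s • z) ≤ ‖z‖ₑ := by
      rw [edist_eq_enorm_sub, sub_add_cancel_left, enorm_neg, enorm_smul]
      refine mul_le_of_le_one_left' ?_
      rw [Real.enorm_eq_ofReal hs.1]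
      simpa using hs.2
    exact absurd hz (not_lt.2 (h1.trans h2))
  · have hm1 : Measurable fun q : EuclideanSpace ℝ (Fin d) × EuclideanSpace ℝ (Fin d) =>
        ∫⁻ s in Ioo (0 : ℝ) 1, ‖g (q.1 + s • q.2) - g q.1‖ₑ := by
      have : Measurable fun r : (EuclideanSpace ℝ (Fin d) × EuclideanSpace ℝ (Fin d)) × ℝ =>
          ‖g (r.1.1 + r.2 • r.1.2) - g r.1.1‖ₑ := by fun_prop
      exact this.lintegral_prod_right'
    have hm2 : Measurable fun q : EuclideanSpace ℝ (Fin d) × EuclideanSpace ℝ (Fin d) =>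
        ‖u (q.1 + q.2) - u q.1 - inner ℝ (g q.1) q.2‖ₑ := by fun_prop
    have hm3 : Measurable fun q : EuclideanSpace ℝ (Fin d) × EuclideanSpace ℝ (Fin d) =>
        Metric.infEDist q.1 Ωᶜ := (Metric.continuous_infEDist.comp continuous_fst).measurable
    have hm4 : Measurable fun q : EuclideanSpace ℝ (Fin d) × EuclideanSpace ℝ (Fin d) =>
        ‖q.2‖ₑ := by fun_prop
    have := (measurableSet_lt hm4 hm3).compl.union (measurableSet_le hm2 (hm4.mul hm1))
    convert this using 1
    ext q
    simp only [mem_ofPred_eq, mem_union, mem_compl_iff]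
    exact imp_iff_not_or

variable {R : ℕ → ℝ → ℝ≥0∞}

theorem tendsto_lintegral_Ioo_of_tail {f : ℕ → ℝ → ℝ≥0∞}
    (hmass : ∀ n, ∫⁻ r in Ioi (0 : ℝ), f n r = 1)
    (htail : ∀ δ : ℝ, 0 < δ → Tendsto (fun n => ∫⁻ r in Ioi δ, f n r) atTop (𝓝 0))
    {δ : ℝ} (hδ : 0 < δ) :
    Tendsto (fun n => ∫⁻ r in Ioo 0 δ, f n r) atTop (𝓝 1) := by
  have hI : ∀ n, ∫⁻ r in Ioo 0 δ, f n r = 1 - ∫⁻ r in Ioi δ, f n r := by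
    intro n
    have h1 : Ioi (0 : ℝ) = Ioo 0 δ ∪ Ici δ := (Ioo_union_Ici_eq_Ioi hδ).symm
    have hd : Disjoint (Ioo 0 δ) (Ici δ) := by
      rw [Set.disjoint_left]; intro r hr hr'; exact absurd hr.2 (not_lt.2 hr')
    have h2 := hmass n
    rw [h1, lintegral_union measurableSet_Ici hd, setLIntegral_congr Ioi_ae_eq_Ici.symm] at h2
    refine ENNReal.eq_sub_of_add_eq ?_ h2
    exact ne_top_of_le_ne_top ENNReal.one_ne_top (h2 ▸ le_add_self)
  simp_rw [hI]
  simpa using ENNReal.Tendsto.sub (tendsto_const_nhds (x := (1 : ℝ≥0∞))) (htail δ hδ)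
    (Or.inl ENNReal.one_ne_top)

/-- The part of the difference quotient away from the base point vanishes in the limit. -/
theorem HasWeakGradient.tendsto_lintegral_away (hΩ : IsSmoothBoundedDomain Ω)
    (hw : HasWeakGradient Ω u g) (hum : StronglyMeasurable u)
    (hu : Integrable u) (hgm : StronglyMeasurable g) (hg : Integrable g) {p : ℝ} (hp : 1 ≤ p)
    (hup : ∫⁻ z, ‖u z‖ₑ ^ p ≠ ⊤) (hgp : ∫⁻ z, ‖g z‖ₑ ^ p ≠ ⊤)
    [Nontrivial (EuclideanSpace ℝ (Fin d))]
    (hR : ∀ n, Measurable (R n))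
    (htail : ∀ δ : ℝ, 0 < δ →
      Tendsto (fun n => ∫⁻ r in Ioi δ, R n r * ENNReal.ofReal (r ^ (d - 1))) atTop (𝓝 0))
    (x : EuclideanSpace ℝ (Fin d)) {δ : ℝ} (hδ : 0 < δ) :
    Tendsto (fun n => ∫⁻ y in Ω \ Metric.ball x δ,
      R n ‖y - x‖ * (‖u y - u x‖ₑ / ‖y - x‖ₑ) ^ p) atTop (𝓝 0) := by
  have hp0 : 0 ≤ p := by linarith
  -- The boundary estimate involves `dr`, the mollifier condition `r ^ (d - 1) dr`. Since `r > δ /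
  -- 2`, the missing Jacobian costs only a constant.
  obtain ⟨C, hC, hCR⟩ := hw.exists_lintegral_radial_le hΩ hum hu hgm hg hp hup hgp x
    (r₀ := δ / 2) (δ := δ) (by positivity) (by linarith)
  set A : ℝ≥0∞ := (ENNReal.ofReal δ)⁻¹ ^ p * 2 ^ (p - 1) with hA
  have hδ0 : ENNReal.ofReal δ ≠ 0 := by simpa using hδ
  have hAt : A ≠ ⊤ := ENNReal.mul_ne_top
    (ENNReal.rpow_ne_top_of_nonneg hp0 (ENNReal.inv_ne_top.2 hδ0))
    (ENNReal.rpow_ne_top_of_nonneg (by linarith) (by simp))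
  have hpow0 : ENNReal.ofReal ((δ / 2) ^ (d - 1)) ≠ 0 := by
    have : 0 < (δ / 2) ^ (d - 1) := by positivity
    simpa using this
  set S : ℝ≥0∞ := (volume : Measure (EuclideanSpace ℝ (Fin d))).toSphere univ with hS
  have hSt : S ≠ ⊤ := measure_ne_top _ _
  set T : ℕ → ℝ≥0∞ := fun n =>
    ∫⁻ r in Ioi (δ / 2), R n r * ENNReal.ofReal (r ^ (d - 1)) with hT
  have hC2 : A * (C * (ENNReal.ofReal ((δ / 2) ^ (d - 1)))⁻¹ + ‖u x‖ₑ ^ p * S) ≠ ⊤ :=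
    ENNReal.mul_ne_top hAt (ENNReal.add_ne_top.2
      ⟨ENNReal.mul_ne_top hC (ENNReal.inv_ne_top.2 hpow0),
        ENNReal.mul_ne_top (ENNReal.rpow_ne_top_of_nonneg hp0 enorm_ne_top) hSt⟩)
  have hlim := ENNReal.Tendsto.const_mul (htail (δ / 2) (by positivity)) (Or.inr hC2)
  rw [mul_zero] at hlim
  refine tendsto_of_tendsto_of_tendsto_of_le_of_le tendsto_const_nhds hlim
    (fun _ => zero_le) fun n => ?_
  have hRn : Measurable fun y : EuclideanSpace ℝ (Fin d) => R n ‖y - x‖ := (hR n).comp (by fun_prop)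
  have hU : Measurable fun z => ‖u z‖ₑ ^ p := hum.measurable.enorm.pow_const p
  have hDm : MeasurableSet (Ω \ Metric.ball x δ) :=
    hΩ.isOpen.measurableSet.diff Metric.isOpen_ball.measurableSet
  have hb1 : ∫⁻ y in Ω \ Metric.ball x δ, ‖u y‖ₑ ^ p * R n ‖y - x‖ ≤
      C * ((ENNReal.ofReal ((δ / 2) ^ (d - 1)))⁻¹ * T n) := by
    refine (hCR (R n) (hR n)).trans ?_
    gcongr
    rw [hT, ← lintegral_const_mul' _ _ (ENNReal.inv_ne_top.2 hpow0)]
    refine setLIntegral_mono' measurableSet_Ioi fun r hr => ?_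
    rw [mul_left_comm]
    refine le_mul_of_one_le_right zero_le ?_
    rw [← ENNReal.inv_mul_cancel hpow0 ENNReal.ofReal_ne_top]
    gcongr
    exact (mem_Ioi.1 hr).le
  have hb2 : ∫⁻ y in Ω \ Metric.ball x δ, R n ‖y - x‖ ≤ T n * S := by
    calc ∫⁻ y in Ω \ Metric.ball x δ, R n ‖y - x‖
        ≤ ∫⁻ y in (Metric.ball x δ)ᶜ, R n ‖y - x‖ := lintegral_mono_set fun y hy => hy.2
      _ = ∫⁻ z in (Metric.ball (0 : EuclideanSpace ℝ (Fin d)) δ)ᶜ, R n ‖z‖ := by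
        rw [← setLIntegral_preimage_add_left Metric.isOpen_ball.measurableSet.compl _ x]
        have : (fun z => x + z) ⁻¹' (Metric.ball x δ)ᶜ = (Metric.ball 0 δ)ᶜ := by
          ext z; simp
        simp [this]
      _ ≤ T n * S := by
        rw [lintegral_compl_ball_radial (hR n) hδ, finrank_euclideanSpace_fin]
        gcongr
        exact lintegral_mono_set (Ici_subset_Ioi.2 (by linarith))
  calc ∫⁻ y in Ω \ Metric.ball x δ, R n ‖y - x‖ * (‖u y - u x‖ₑ / ‖y - x‖ₑ) ^ p
      ≤ ∫⁻ y in Ω \ Metric.ball x δ,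
          A * (‖u y‖ₑ ^ p * R n ‖y - x‖ + ‖u x‖ₑ ^ p * R n ‖y - x‖) := by
        refine setLIntegral_mono' hDm fun y hy => ?_
        have hy' : ENNReal.ofReal δ ≤ ‖y - x‖ₑ := by
          rw [← ofReal_norm]
          refine ENNReal.ofReal_le_ofReal ?_
          simpa [dist_eq_norm] using hy.2
        have h1 : (‖u y - u x‖ₑ / ‖y - x‖ₑ) ^ p ≤ A * (‖u y‖ₑ ^ p + ‖u x‖ₑ ^ p) := by
          calc (‖u y - u x‖ₑ / ‖y - x‖ₑ) ^ p
              ≤ ((ENNReal.ofReal δ)⁻¹ * (‖u y‖ₑ + ‖u x‖ₑ)) ^ p := by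
                refine ENNReal.rpow_le_rpow ?_ hp0
                rw [ENNReal.div_eq_inv_mul]
                gcongr
                exact enorm_sub_le
            _ ≤ _ := by
                rw [ENNReal.mul_rpow_of_nonneg _ _ hp0, hA, mul_assoc]
                gcongr
                exact ENNReal.rpow_add_le_mul_rpow_add_rpow _ _ hp
        calc _ ≤ R n ‖y - x‖ * (A * (‖u y‖ₑ ^ p + ‖u x‖ₑ ^ p)) := by gcongr
          _ = _ := by ring
    _ = A * ((∫⁻ y in Ω \ Metric.ball x δ, ‖u y‖ₑ ^ p * R n ‖y - x‖) +
          ‖u x‖ₑ ^ p * ∫⁻ y in Ω \ Metric.ball x δ, R n ‖y - x‖) :=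
        lintegral_const_mul_add_const_mul (f := fun y => ‖u y‖ₑ ^ p * R n ‖y - x‖)
          (hU.mul hRn) hRn _ _
    _ ≤ A * (C * ((ENNReal.ofReal ((δ / 2) ^ (d - 1)))⁻¹ * T n) + ‖u x‖ₑ ^ p * (T n * S)) := by
        gcongr
    _ = _ := by simp only [hT]; ring

/-- The limit of the weighted difference quotients, for Borel representatives. -/
theorem HasWeakGradient.ae_tendsto_lintegral (hΩ : IsSmoothBoundedDomain Ω)
    (hw : HasWeakGradient Ω u g) (hum : StronglyMeasurable u)
    (hu : Integrable u) (hgm : StronglyMeasurable g) (hg : Integrable g) {p : ℝ} (hp : 1 ≤ p)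
    (hup : ∫⁻ z, ‖u z‖ₑ ^ p ≠ ⊤) (hgp : ∫⁻ z, ‖g z‖ₑ ^ p ≠ ⊤)
    (hR : ∀ n, Measurable (R n))
    (hmass : ∀ n, ∫⁻ r in Ioi (0 : ℝ), R n r * ENNReal.ofReal (r ^ (d - 1)) = 1)
    (htail : ∀ δ : ℝ, 0 < δ →
      Tendsto (fun n => ∫⁻ r in Ioi δ, R n r * ENNReal.ofReal (r ^ (d - 1))) atTop (𝓝 0))
    {e : EuclideanSpace ℝ (Fin d)} (he : ‖e‖ = 1) :
    ∀ᵐ x, x ∈ Ω → Tendsto (fun n => ∫⁻ y in Ω,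
      R n ‖y - x‖ * (‖u y - u x‖ₑ / ‖y - x‖ₑ) ^ p) atTop
      (𝓝 (ENNReal.ofReal (gammaConst p e * ‖g x‖ ^ p))) := by
  have : Nontrivial (EuclideanSpace ℝ (Fin d)) := ⟨⟨e, 0, by rintro rfl; simp at he⟩⟩
  have hum' := hum.measurable
  have hgm' := hgm.measurable
  have hΩm := hΩ.isOpen.measurableSet
  filter_upwards [hw.ae_ae_enorm_sub_sub_inner_le hΩ.isOpen hum hu hgm hg,
    ae_lintegral_ball_rpow_sub_le hΩ.isOpen hΩ.isBounded.measure_lt_top.ne hgm' hp hgp]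
    with x hx hleb hxΩ
  set W : Set (EuclideanSpace ℝ (Fin d)) := (fun z => x + z) ⁻¹' Ω with hWdef
  have hW : MeasurableSet W := (measurable_const_add x) hΩm
  set q : EuclideanSpace ℝ (Fin d) → ℝ≥0∞ := fun z => ‖u (x + z) - u x‖ₑ / ‖z‖ₑ with hqdef
  set l : EuclideanSpace ℝ (Fin d) → ℝ≥0∞ := fun z => ‖inner ℝ (g x) z‖ₑ / ‖z‖ₑ with hldef
  have hq : Measurable q := by
    simp only [hqdef]; fun_prop
  have hl : Measurable l := by
    simp only [hldef]; fun_prop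
  have hpre : ∀ n, ∀ S, MeasurableSet S →
      ∫⁻ y in S, R n ‖y - x‖ * (‖u y - u x‖ₑ / ‖y - x‖ₑ) ^ p =
      ∫⁻ z in (fun z => x + z) ⁻¹' S, R n ‖z‖ * q z ^ p := by
    intro n S hS
    rw [← setLIntegral_preimage_add_left hS _ x]
    simp [hqdef]
  simp_rw [fun n => hpre n Ω hΩm]
  refine tendsto_lintegral_rpow_mul_radial hp hW hR hq hl ENNReal.ofReal_ne_top ?_ ?_ ?_
  · intro δ hδ
    have hpol : ∀ n, ∫⁻ z in Metric.ball (0 : EuclideanSpace ℝ (Fin d)) δ, R n ‖z‖ * l z ^ p =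
        (∫⁻ r in Ioo 0 δ, R n r * ENNReal.ofReal (r ^ (d - 1))) *
          ENNReal.ofReal (gammaConst p e * ‖g x‖ ^ p) := by
      intro n
      rw [lintegral_ball_polar (hl.pow_const p) (hR n), ← lintegral_mul_const _ (by fun_prop),
        finrank_euclideanSpace_fin]
      refine setLIntegral_congr_fun measurableSet_Ioo fun r hr => ?_
      rw [← lintegral_sphere_inner_rpow hp he (g x)]
      congr 1
      refine lintegral_congr fun σ => ?_
      have hr0 : ‖r‖ₑ ≠ 0 := by simpa using hr.1.ne'
      have hσ : ‖(σ : EuclideanSpace ℝ (Fin d))‖ₑ = 1 := by rw [← ofReal_norm]; simp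
      simp only [hldef, inner_smul_right, enorm_mul, enorm_smul, hσ, mul_one]
      rw [mul_comm, ENNReal.mul_div_cancel_right hr0 enorm_ne_top]
    simp_rw [hpol]
    simpa using ENNReal.Tendsto.mul_const (tendsto_lintegral_Ioo_of_tail hmass htail hδ)
      (Or.inr ENNReal.ofReal_ne_top)
  · intro δ hδ
    have h := hw.tendsto_lintegral_away hΩ hum hu hgm hg hp hup hgp hR htail x hδ
    simp_rw [fun n => hpre n _ (hΩm.diff (Metric.isOpen_ball (x := x) (ε := δ)).measurableSet)] at h
    have hset : (fun z => x + z) ⁻¹' (Ω \ Metric.ball x δ) = W \ Metric.ball 0 δ := by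
      ext z; simp [hWdef]
    rwa [hset] at h
  · intro ε hε
    have h2d : (2 : ℝ≥0∞) ^ d ≠ ⊤ := by simp
    -- Dividing by `2 ^ d` absorbs the constant of the ray estimate; the mass of the mollifier on
    -- `(0, δ)` is at most 1, so the bound `ε` is uniform in `n`.
    obtain ⟨δ₁, hδ₁, h1⟩ := hleb hxΩ (ε / 2 ^ d) (ENNReal.div_pos hε h2d).ne'
    obtain ⟨δ₂, hδ₂, h2⟩ := Metric.isOpen_iff.1 hΩ.isOpen x hxΩ
    have hGm : Measurable fun r : EuclideanSpace ℝ (Fin d) × ℝ =>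
        ‖g (x + r.2 • r.1) - g x‖ₑ := by fun_prop
    refine ⟨min δ₁ δ₂, lt_min hδ₁ hδ₂, ?_,
      fun z => ∫⁻ s in Ioo (0 : ℝ) 1, ‖g (x + s • z) - g x‖ₑ, hGm.lintegral_prod_right', ?_, ?_⟩
    · intro z hz
      refine h2 ?_
      have := (mem_ball_zero_iff.1 hz).trans_le (min_le_right _ _)
      simpa using this
    · filter_upwards [hx, Measure.ae_ne volume (0 : EuclideanSpace ℝ (Fin d))] with z hz hz0 hzB
      have hzn : ‖z‖ < δ₂ := (mem_ball_zero_iff.1 hzB).trans_le (min_le_right _ _)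
      have hz1 : ‖z‖ₑ < Metric.infEDist x Ωᶜ := by
        refine lt_of_lt_of_le (b := ENNReal.ofReal δ₂) ?_ ?_
        · rw [← ofReal_norm]
          exact (ENNReal.ofReal_lt_ofReal_iff hδ₂).2 hzn
        · refine Metric.le_infEDist.2 fun y hy => ?_
          rw [edist_dist]
          refine ENNReal.ofReal_le_ofReal ?_
          by_contra hlt
          exact hy (h2 (by rw [Metric.mem_ball, dist_comm]; exact not_le.1 hlt))
      have hz2 := hz hz1
      have hze : ‖z‖ₑ ≠ 0 := by simpa using hz0
      have hdiv : ∀ a b c : ℝ≥0∞, a ≤ b + ‖z‖ₑ * c → a / ‖z‖ₑ ≤ b / ‖z‖ₑ + c := by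
        intro a b c h
        refine (ENNReal.div_le_div_right h _).trans (le_of_eq ?_)
        rw [ENNReal.add_div, mul_comm, ENNReal.mul_div_cancel_right hze enorm_ne_top]
      constructor
      · refine hdiv _ _ _ ?_
        calc ‖u (x + z) - u x‖ₑ
            = ‖inner ℝ (g x) z + (u (x + z) - u x - inner ℝ (g x) z)‖ₑ := by
              rw [add_sub_cancel]
          _ ≤ ‖inner ℝ (g x) z‖ₑ + ‖u (x + z) - u x - inner ℝ (g x) z‖ₑ := enorm_add_le _ _
          _ ≤ _ := by gcongr
      · refine hdiv _ _ _ ?_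
        calc ‖inner ℝ (g x) z‖ₑ
            = ‖(u (x + z) - u x) - (u (x + z) - u x - inner ℝ (g x) z)‖ₑ := by
              rw [sub_sub_cancel]
          _ ≤ ‖u (x + z) - u x‖ₑ + ‖u (x + z) - u x - inner ℝ (g x) z‖ₑ := enorm_sub_le
          _ ≤ _ := by gcongr
    · intro n
      have hG : Measurable fun z => ‖g (x + z) - g x‖ₑ ^ p := by fun_prop
      calc ∫⁻ z in Metric.ball (0 : EuclideanSpace ℝ (Fin d)) (min δ₁ δ₂),
            R n ‖z‖ * (∫⁻ s in Ioo (0 : ℝ) 1, ‖g (x + s • z) - g x‖ₑ) ^ p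
          ≤ ∫⁻ z in Metric.ball (0 : EuclideanSpace ℝ (Fin d)) (min δ₁ δ₂),
            R n ‖z‖ * ∫⁻ s in Ioo (0 : ℝ) 1, ‖g (x + s • z) - g x‖ₑ ^ p := by
            refine lintegral_mono fun z => ?_
            gcongr
            have hgz : Measurable fun s : ℝ => ‖g (x + s • z) - g x‖ₑ := by fun_prop
            refine (ENNReal.lintegral_rpow_le_measure_mul hp hgz.aemeasurable).trans (le_of_eq ?_)
            simp
        _ ≤ 2 ^ d * (ε / 2 ^ d) *
            ∫⁻ r in Ioo 0 (min δ₁ δ₂), R n r * ENNReal.ofReal (r ^ (d - 1)) := by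
            have := lintegral_radial_segment_le hG (hR n) (η := ε / 2 ^ d) (δ := min δ₁ δ₂)
              (fun b hb => h1 b ⟨hb.1, hb.2.trans_le (min_le_left _ _)⟩)
            simpa only [finrank_euclideanSpace_fin] using this
        _ ≤ ε * 1 := by
            gcongr
            · exact ENNReal.mul_div_le
            · rw [← hmass n]
              exact lintegral_mono_set Ioo_subset_Ioi_self
        _ = ε := mul_one ε

end DifferenceQuotient

/-! ### Borel representatives and conclusion. -/

section Main

variable {d : ℕ} {Ω : Set (EuclideanSpace ℝ (Fin d))} {u : EuclideanSpace ℝ (Fin d) → ℝ}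
  {g : EuclideanSpace ℝ (Fin d) → EuclideanSpace ℝ (Fin d)}

theorem HasWeakGradient.congr (hw : HasWeakGradient Ω u g)
    {u' : EuclideanSpace ℝ (Fin d) → ℝ}
    {g' : EuclideanSpace ℝ (Fin d) → EuclideanSpace ℝ (Fin d)}
    (hu : u =ᵐ[volume.restrict Ω] u') (hg : g =ᵐ[volume.restrict Ω] g')
    (hu' : Integrable u') (hg' : Integrable g') : HasWeakGradient Ω u' g' where
  locallyIntegrableOn := hu'.locallyIntegrable.locallyIntegrableOn _
  locallyIntegrableOn_grad := hg'.locallyIntegrable.locallyIntegrableOn _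
  integral_eq := by
    intro φ hφ hc hs v
    have h1 : ∫ x in Ω, u' x * fderiv ℝ φ x v = ∫ x in Ω, u x * fderiv ℝ φ x v := by
      refine integral_congr_ae ?_
      filter_upwards [hu] with x hx
      rw [hx]
    have h2 : ∫ x in Ω, inner ℝ (g' x) v * φ x = ∫ x in Ω, inner ℝ (g x) v * φ x := by
      refine integral_congr_ae ?_
      filter_upwards [hg] with x hx
      rw [hx]
    rw [h1, h2]
    exact hw.integral_eq φ hφ hc hs v

/-- A function in `L^p(Ω)`, with `Ω` of finite measure, has a Borel representative which vanishes
outside `Ω`. -/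
theorem exists_stronglyMeasurable_representative {α F : Type*} [MeasurableSpace α]
    {μ : Measure α} [NormedAddCommGroup F] {Ω : Set α} (hΩ : MeasurableSet Ω) (hΩf : μ Ω ≠ ⊤)
    {p : ℝ} (hp : 1 ≤ p) {f : α → F} (hf : MemLp f (ENNReal.ofReal p) (μ.restrict Ω)) :
    ∃ f' : α → F, StronglyMeasurable f' ∧ f =ᵐ[μ.restrict Ω] f' ∧ Integrable f' μ ∧
      ∫⁻ z, ‖f' z‖ₑ ^ p ∂μ ≠ ⊤ := by
  have hp0 : 0 < p := by linarith
  have : IsFiniteMeasure (μ.restrict Ω) := ⟨by simpa using hΩf.lt_top⟩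
  have hsm := hf.1.stronglyMeasurable_mk
  have hae : f =ᵐ[μ.restrict Ω] Ω.indicator (hf.1.mk f) := by
    filter_upwards [hf.1.ae_eq_mk, ae_restrict_mem hΩ] with x hx hxΩ
    rw [indicator_of_mem hxΩ, hx]
  refine ⟨Ω.indicator (hf.1.mk f), hsm.indicator hΩ, hae, ?_, ?_⟩
  · rw [integrable_indicator_iff hΩ]
    have h1 : 1 ≤ ENNReal.ofReal p := by simpa using hp
    exact (hf.integrable h1).congr hf.1.ae_eq_mk
  · have h1 := lintegral_rpow_enorm_lt_top_of_eLpNorm_lt_top (p := ENNReal.ofReal p)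
      (by simpa using hp0) ENNReal.ofReal_ne_top hf.2
    rw [ENNReal.toReal_ofReal hp0.le] at h1
    have h2 : ∫⁻ z, ‖Ω.indicator (hf.1.mk f) z‖ₑ ^ p ∂μ = ∫⁻ z in Ω, ‖f z‖ₑ ^ p ∂μ := by
      calc ∫⁻ z, ‖Ω.indicator (hf.1.mk f) z‖ₑ ^ p ∂μ
          = ∫⁻ z in Ω, ‖hf.1.mk f z‖ₑ ^ p ∂μ := by
            rw [← lintegral_indicator hΩ]
            refine lintegral_congr fun z => ?_
            by_cases hz : z ∈ Ω <;> simp [hz, hp0]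
        _ = _ := by
            refine lintegral_congr_ae ?_
            filter_upwards [hf.1.ae_eq_mk] with z hz
            rw [hz]
    rw [h2]
    exact h1.ne

/-- Borel extended-nonnegative versions of the profiles of a sequence of radial mollifiers. -/
theorem IsRadialMollifierSeq.exists_measurable {ρ : ℕ → ℝ → ℝ} (hρ : IsRadialMollifierSeq d ρ) :
    ∃ R : ℕ → ℝ → ℝ≥0∞, (∀ n, Measurable (R n)) ∧
      (∀ n, ∀ᵐ r ∂(volume.restrict (Ioi (0 : ℝ))), ENNReal.ofReal (ρ n r) = R n r) ∧
      (∀ n, ∫⁻ r in Ioi (0 : ℝ), R n r * ENNReal.ofReal (r ^ (d - 1)) = 1) ∧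
      ∀ δ : ℝ, 0 < δ →
        Tendsto (fun n => ∫⁻ r in Ioi δ, R n r * ENNReal.ofReal (r ^ (d - 1))) atTop (𝓝 0) := by
  have hm : ∀ n, AEStronglyMeasurable (ρ n) (volume.restrict (Ioi 0)) := fun n =>
    (hρ.locallyIntegrableOn n).aestronglyMeasurable
  have hae : ∀ n, ∀ᵐ r ∂(volume.restrict (Ioi (0 : ℝ))),
      ENNReal.ofReal (ρ n r) = ENNReal.ofReal ((hm n).mk (ρ n) r) := fun n => by
    filter_upwards [(hm n).ae_eq_mk] with r hr
    rw [hr]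
  -- A non-integrable function has Bochner integral 0, so the value 1 forces integrability.
  have hint : ∀ n, IntegrableOn (fun r => ρ n r * r ^ (d - 1)) (Ioi 0) := by
    intro n
    by_contra h
    have := hρ.integral_eq_one n
    rw [integral_undef h] at this
    exact zero_ne_one this
  have key : ∀ n, ∀ δ : ℝ, 0 ≤ δ →
      ∫⁻ r in Ioi δ, ENNReal.ofReal ((hm n).mk (ρ n) r) * ENNReal.ofReal (r ^ (d - 1)) =
        ENNReal.ofReal (∫ r in Ioi δ, ρ n r * r ^ (d - 1)) := by
    intro n δ hδ
    have hsub : Ioi δ ⊆ Ioi 0 := Ioi_subset_Ioi hδ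
    have hnn : ∀ r ∈ Ioi δ, 0 ≤ ρ n r * r ^ (d - 1) := fun r hr =>
      mul_nonneg (hρ.nonneg n r (hsub hr)) (pow_nonneg (hsub hr).le _)
    rw [ofReal_integral_eq_lintegral_ofReal ((hint n).mono_set hsub)
      (by filter_upwards [ae_restrict_mem measurableSet_Ioi] with r hr using hnn r hr)]
    refine lintegral_congr_ae ?_
    filter_upwards [ae_restrict_of_ae_restrict_of_subset hsub (hae n),
      ae_restrict_mem measurableSet_Ioi] with r hr hrδ
    rw [← hr, ENNReal.ofReal_mul (hρ.nonneg n r (hsub hrδ))]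
  refine ⟨fun n r => ENNReal.ofReal ((hm n).mk (ρ n) r),
    fun n => (hm n).stronglyMeasurable_mk.measurable.ennreal_ofReal, hae, fun n => ?_,
    fun δ hδ => ?_⟩
  · rw [key n 0 le_rfl, hρ.integral_eq_one n, ENNReal.ofReal_one]
  · simp_rw [fun n => key n δ hδ.le]
    simpa using ENNReal.tendsto_ofReal (hρ.tendsto_tail δ hδ)

end Main

theorem mainTheorem6 (d : ℕ) (hd : 1 ≤ d) (p : ℝ) (hp : 1 ≤ p)
    (Ω : Set (EuclideanSpace ℝ (Fin d))) (hΩ : IsSmoothBoundedDomain Ω)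
    (ρ : ℕ → ℝ → ℝ) (hρ : IsRadialMollifierSeq d ρ)
    (e : EuclideanSpace ℝ (Fin d)) (he : ‖e‖ = 1)
    (u : EuclideanSpace ℝ (Fin d) → ℝ) (hu : MemSobolevOne Ω p u)
    (gradu : EuclideanSpace ℝ (Fin d) → EuclideanSpace ℝ (Fin d))
    (hgradu : HasWeakGradient Ω u gradu) :
    ∀ᵐ x ∂(volume.restrict Ω),
      Tendsto (fun n => truncatedD Ω p (ρ n) u x) atTop
        (𝓝 (ENNReal.ofReal (gammaConst p e * ‖gradu x‖ ^ p))) := by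
  have hp0 : 0 ≤ p := by linarith
  have : Nontrivial (EuclideanSpace ℝ (Fin d)) := ⟨⟨e, 0, by rintro rfl; simp at he⟩⟩
  have hΩm := hΩ.isOpen.measurableSet
  have hΩf : volume Ω ≠ ⊤ := hΩ.isBounded.measure_lt_top.ne
  obtain ⟨hup, g, hg, hgp⟩ := hu
  obtain ⟨u', hum, hueq, hui, hu'p⟩ := exists_stronglyMeasurable_representative hΩm hΩf hp hup
  obtain ⟨g', hgm, hgeq, hgi, hg'p⟩ := exists_stronglyMeasurable_representative hΩm hΩf hp hgp
  obtain ⟨R, hR, hRρ, hmass, htail⟩ := hρ.exists_measurable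
  have key := (hg.congr hueq hgeq hui hgi).ae_tendsto_lintegral hΩ hum hui hgm hgi hp hu'p hg'p
    hR hmass htail he
  filter_upwards [ae_restrict_of_ae key, ae_restrict_mem hΩm, hueq, hgeq,
    hgradu.ae_eq hΩ.isOpen hg] with x hx hxΩ hux hgx hgradx
  rw [hgradx, hgx]
  refine (hx hxΩ).congr fun n => ?_
  rw [truncatedD]
  refine lintegral_congr_ae ?_
  -- The profile agrees with its Borel version only for almost every radius; polar coordinates
  -- around `x` carry this to almost every `y`.
  have h1 : ∀ᵐ y : EuclideanSpace ℝ (Fin d), ENNReal.ofReal (ρ n ‖y - x‖) = R n ‖y - x‖ :=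
    (measurePreserving_sub_right volume x).quasiMeasurePreserving.ae (ae_norm_of_ae_Ioi (hRρ n))
  filter_upwards [hueq, ae_restrict_of_ae h1, ae_restrict_of_ae (Measure.ae_ne volume x)]
    with y huy hρy hyx
  have hpos : 0 < ‖y - x‖ := norm_pos_iff.2 (sub_ne_zero.2 hyx)
  rw [← huy, ← hux, ← hρy, norm_sub_rev x y, abs_sub_comm, mul_comm,
    ← Real.div_rpow (abs_nonneg _) hpos.le, ENNReal.ofReal_mul (by positivity),
    ← ENNReal.ofReal_rpow_of_nonneg (by positivity) hp0, ENNReal.ofReal_div_of_pos hpos,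
    ofReal_norm, Real.enorm_eq_ofReal_abs]
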